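/- Let $X$ be a complex Banach space, let $L(X)$ be the algebra of bounded linear operators on $X$, $K(X)\subseteq L(X)$ the closed ideal of compact operators, and $\pi\colon L(X)\to C(X)=L(X)/K(X)$ the quotient map onto the Calkin algebra (with the quotient norm). For an element $a$ of a complex unital Banach algebra, let $\operatorname{iso}\sigma(a)$ be the set of points of the spectrum $\sigma(a)$ that are not limit points of $\sigma(a)$; let $\Pi(a)\subseteq\operatorname{iso}\sigma(a)$ be the set of poles of the resolvent $z\mapsto (z-a)^{-1}$, that is, of those $z_0\in\operatorname{iso}\sigma(a)$ for which there is $p\ge 1$ such that, in the Laurent expansion of the resolvent at $z_0$, the coefficient of $(z-z_0)^{-p}$ is non-zero and the coefficient of $(z-z_0)^{-m}$ is zero for all $m>p$; and let $I(a)=\operatorname{iso}\sigma(a)\setminus\Pi(a)$. A bounded operator $S$ on a Banach space $Y$ is *Fredholm* if its range is closed and its kernel and cokernel $Y/S(Y)$ are finite dimensional; it is *Riesz* if its class in the Calkin algebra $C(Y)$ is quasi-nilpotent (has spectral radius $0$); it is *power compact* if $S^n$ is compact for some integer $n\ge 1$. Let $T\in L(X)$ and $\lambda\in\mathbb{C}$.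 For an idempotent $P\in L(X)$ put $X_1=P(X)$ and $X_2=(I-P)(X)$, and for $T_1\in L(X_1)$, $T_2\in L(X_2)$ let $T_1\oplus T_2\in L(X)$ be the operator $x\mapsto T_1Px+T_2(I-P)x$. Then: (i) $\lambda\in\operatorname{iso}\sigma(\pi(T))$ if and only if there exist an idempotent $P\in L(X)$ with $P\notin K(X)$, a Riesz operator $T_1\in L(X_1)$, a Fredholm operator $T_2\in L(X_2)$ and $K\in K(X)$ such that $T-\lambda I=T_1\oplus T_2+K$. (ii) $\lambda\in\Pi(\pi(T))$ if and only if there exist an idempotent $P\in L(X)$ with $P\notin K(X)$, a power compact operator $T_1\in L(X_1)$, a Fredholm operator $T_2\in L(X_2)$ and $K\in K(X)$ such that $T-\lambda I=T_1\oplus T_2+K$. (iii) $\lambda\in I(\pi(T))$ if and only if there exist an idempotent $P\in L(X)$ with $P\notin K(X)$, an operator $T_1\in L(X_1)$ that is Riesz but not power compact, a Fredholm operator $T_2\in L(X_2)$ and $K\in K(X)$ such that $T-\lambda I=T_1\oplus T_2+K$. -/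

import Mathlib

open Filter Topology

noncomputable section

namespace CalkinTheory

section Calkin

variable (X : Type*) [NormedAddCommGroup X] [NormedSpace ℂ X]

/-- The ideal `K(X)` of compact operators in the algebra `L(X)` of bounded linear operators. -/
def compactIdeal : Ideal (X →L[ℂ] X) where
  carrier := {T | IsCompactOperator T}
  zero_mem' := isCompactOperator_zero
  add_mem' := fun hS hT => IsCompactOperator.add hS hT
  smul_mem' := fun S _ hT => IsCompactOperator.clm_comp hT S

instance compactIdeal_isTwoSided : (compactIdeal X).IsTwoSided where
  mul_mem_of_left {_} S hT := IsCompactOperator.comp_clm hT S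

/-- The Calkin algebra `C(X) = L(X) / K(X)`. -/
abbrev Calkin : Type _ := (X →L[ℂ] X) ⧸ compactIdeal X

/-- The quotient map `π : L(X) → C(X)`. -/
def calkinMk : (X →L[ℂ] X) →ₐ[ℂ] Calkin X := Ideal.Quotient.mkₐ ℂ (compactIdeal X)

theorem isClosed_compactIdeal [CompleteSpace X] :
    IsClosed (compactIdeal X : Set (X →L[ℂ] X)) :=
  isClosed_setOfPred_isCompactOperator

/-- The Calkin algebra of a Banach space is a normed ring for the quotient norm. -/
instance calkinNormedRing [CompleteSpace X] : NormedRing (Calkin X) :=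
  { Ideal.Quotient.ring (compactIdeal X),
    @Submodule.Quotient.normedAddCommGroup _ _ _ _ _ (compactIdeal X)
      (isClosed_compactIdeal X) with
    norm_mul_le := by
      intro x y
      have key : ∀ ε : ℝ, 0 < ε → ‖x * y‖ ≤ (‖x‖ + ε) * (‖y‖ + ε) := by
        intro ε hε
        obtain ⟨a, rfl, ha⟩ := Submodule.Quotient.norm_mk_lt x hε
        obtain ⟨b, rfl, hb⟩ := Submodule.Quotient.norm_mk_lt y hε
        calc ‖(Submodule.Quotient.mk (a * b) : Calkin X)‖ ≤ ‖a * b‖ :=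
              Submodule.Quotient.norm_mk_le _ _
          _ ≤ ‖a‖ * ‖b‖ := norm_mul_le a b
          _ ≤ _ := mul_le_mul ha.le hb.le (norm_nonneg _) ((norm_nonneg _).trans ha.le)
      have h1 : Tendsto (fun ε : ℝ => (‖x‖ + ε) * (‖y‖ + ε)) (𝓝[>] 0)
          (𝓝 ((‖x‖ + 0) * (‖y‖ + 0))) := by
        apply Tendsto.mono_left _ nhdsWithin_le_nhds
        exact (Continuous.tendsto (by fun_prop) 0)
      simp only [add_zero] at h1
      exact ge_of_tendsto h1 (by
        filter_upwards [self_mem_nhdsWithin] with ε hε using key ε hε) }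

/-- The Calkin algebra of a complex Banach space is a complex normed algebra. -/
instance calkinNormedAlgebra [CompleteSpace X] : NormedAlgebra ℂ (Calkin X) :=
  { (inferInstance : Algebra ℂ (Calkin X)) with
    norm_smul_le := fun c x =>
      (Submodule.Quotient.normedSpace (compactIdeal X) ℂ).norm_smul_le c x }

/-- The Calkin algebra of a complex Banach space is complete. -/
instance calkinCompleteSpace [CompleteSpace X] : CompleteSpace (Calkin X) :=
  Submodule.Quotient.completeSpace (compactIdeal X)

end Calkin

section BanachAlgebra

variable {A : Type*} [NormedRing A] [NormedAlgebra ℂ A]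

/-- `iso σ(a)`: the points of the spectrum of `a` that are not limit points of it. -/
def isoSpectrum (a : A) : Set ℂ :=
  {z | z ∈ spectrum ℂ a ∧ ¬ AccPt z (𝓟 (spectrum ℂ a))}

/-- `z₀` is a pole of order `p` of the resolvent function `z ↦ (z - a)⁻¹`: an isolated
point of the spectrum at which the Laurent expansion of the resolvent has `b_p ≠ 0`
and `b_m = 0` for all `m > p`, where `p ≥ 1`. -/
def IsPoleOfOrder (a : A) (z₀ : ℂ) (p : ℕ) : Prop :=
  z₀ ∈ isoSpectrum a ∧ 1 ≤ p ∧ MeromorphicAt (resolvent a) z₀ ∧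
    meromorphicOrderAt (resolvent a) z₀ = ((-(p : ℤ) : ℤ) : WithTop ℤ)

/-- `Π(a)`: the poles of (the resolvent of) `a`. -/
def poles (a : A) : Set ℂ := {z | ∃ p : ℕ, IsPoleOfOrder a z p}

/-- `I(a) = iso σ(a) \ Π(a)`. -/
def nonpoleIso (a : A) : Set ℂ := isoSpectrum a \ poles a

end BanachAlgebra

section Operators

variable {X : Type*} [NormedAddCommGroup X] [NormedSpace ℂ X]

/-- `T` is a Riesz operator: its class in the Calkin algebra is quasi-nilpotent,
that is, has spectral radius zero. -/
def IsRiesz (T : X →L[ℂ] X) : Prop := spectralRadius ℂ (calkinMk X T) = 0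

/-- `T` is power compact: some positive power of `T` is compact. -/
def IsPowerCompact (T : X →L[ℂ] X) : Prop := ∃ n : ℕ, 1 ≤ n ∧ IsCompactOperator (T ^ n)

/-- The operator `T₁ ⊕ T₂` on `X = P(X) ⊕ (I - P)(X)`, `x ↦ T₁ (P x) + T₂ (x - P x)`
(meant for idempotent `P`). -/
def blockSum (P : X →L[ℂ] X)
    (T₁ : (P.range) →L[ℂ] (P.range)) (T₂ : ((1 - P).range) →L[ℂ] ((1 - P).range)) :
    X →L[ℂ] X :=
  (P.range).subtypeL ∘L T₁ ∘L P.codRestrict P.range (fun x => ⟨x, rfl⟩) +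
    ((1 - P).range).subtypeL ∘L T₂ ∘L
      (1 - P).codRestrict ((1 - P).range) (fun x => ⟨x, rfl⟩)

end Operators

end CalkinTheory

end

/-!
An isolated point `z` of the spectrum of an element `a` of a complex Banach algebra is
characterized by a splitting `IsSpectralSplitting a z p b`: a nonzero idempotent `p` commuting with
`a` such that `(a - z) p` is quasi-nilpotent and `a - z` has the inverse `b` in the corner of
`1 - p`. In one direction `p` is the Riesz projection over a small circle around `z`
(`exists_isSpectralSplitting`); in the other, the resolvent near `z` is the sum of the resolvents
of the two parts (`IsSpectralSplitting.resolvent_eq`), the second of which is holomorphic at `z`,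
and Gelfand's formula shows that `z` does lie in the spectrum. By that decomposition of the
resolvent and Liouville's theorem, `z` is a pole if and only if `(a - z) p` is nilpotent
(`IsSpectralSplitting.mem_poles_iff`).

For `a = π(T)` in the Calkin algebra such splittings correspond to decompositions of `T - z` modulo
compact operators. The idempotent `p` lifts to an idempotent operator `P`
(`exists_isIdempotentElem_calkinMk_eq`), and `T - z` is, modulo compacts, the direct sum of its
compressions to the ranges of `P` and `1 - P`; these are Riesz because `(a - z) p` is
quasi-nilpotent, respectively Fredholm because of the inverse `b` and Atkinson's theorem
(`isFredholm_iff_isUnit_calkinMk`). Conversely a decomposition yields a splitting with `p = π(P)`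
(`IsDirectSum.exists_isSpectralSplitting`), in which `(a - z) p` is the class of the Riesz part, so
it is nilpotent exactly when the Riesz part is power compact.

Both lifting and Atkinson's theorem rest on the fact that the spectrum of a compact operator is
finite away from `0` (`finite_spectrum_inter_le_norm`), which provides the circles needed for Riesz
projections of operators that are compact, or idempotent modulo compacts.
-/

namespace CalkinTheory

/-! ### Riesz projections attached to a circle in the resolvent set -/

section RieszProjection

open Metric

variable {A : Type*} [NormedRing A] [NormedAlgebra ℂ A]

theorem commute_resolvent {x a : A} (h : Commute x a) (w : ℂ) : Commute x (resolvent a w) := by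
  have h' : Commute x (algebraMap ℂ A w - a) := (Algebra.commute_algebraMap_right w x).sub_right h
  by_cases hu : IsUnit (algebraMap ℂ A w - a)
  · obtain ⟨u, hu⟩ := hu
    rw [resolvent, ← hu, Ring.inverse_unit]
    rw [← hu] at h'
    exact h'.units_inv_right
  · rw [resolvent, Ring.inverse_non_unit _ hu]
    exact Commute.zero_right x

theorem sub_mul_resolvent {a : A} {w : ℂ} (h : w ∈ resolventSet ℂ a) :
    (algebraMap ℂ A w - a) * resolvent a w = 1 :=
  Ring.mul_inverse_cancel _ h

theorem resolvent_mul_sub {a : A} {w : ℂ} (h : w ∈ resolventSet ℂ a) :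
    resolvent a w * (algebraMap ℂ A w - a) = 1 :=
  Ring.inverse_mul_cancel _ h

variable [CompleteSpace A]

theorem mul_circleIntegral (x : A) {f : ℂ → A} {c : ℂ} {r : ℝ} (hf : CircleIntegrable f c r) :
    x * (∮ w in C(c, r), f w) = ∮ w in C(c, r), x * f w := by
  have h := (ContinuousLinearMap.mul ℂ A x).intervalIntegral_comp_comm hf.out
  simp only [circleIntegral]
  simpa using h.symm

theorem circleIntegral_mul (x : A) {f : ℂ → A} {c : ℂ} {r : ℝ} (hf : CircleIntegrable f c r) :
    (∮ w in C(c, r), f w) * x = ∮ w in C(c, r), f w * x := by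
  have h := ((ContinuousLinearMap.mul ℂ A).flip x).intervalIntegral_comp_comm hf.out
  simp only [circleIntegral]
  simpa using h.symm

theorem commute_circleIntegral {x : A} {f : ℂ → A} {c : ℂ} {r : ℝ}
    (hf : CircleIntegrable f c r) (h : ∀ w, Commute x (f w)) :
    Commute x (∮ w in C(c, r), f w) := by
  rw [Commute, SemiconjBy, mul_circleIntegral x hf, circleIntegral_mul x hf]
  simp only [(h _).eq]

theorem differentiableAt_resolvent {a : A} {w : ℂ} (h : w ∈ resolventSet ℂ a) :
    DifferentiableAt ℂ (resolvent a) w :=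
  (spectrum.hasDerivAt_resolvent_const_left h).differentiableAt

/-- The Riesz projection `(2πi)⁻¹ ∮ (w - a)⁻¹ dw` over the circle with centre `c` and radius `r`. -/
noncomputable def rieszProjection (a : A) (c : ℂ) (r : ℝ) : A :=
  (2 * Real.pi * Complex.I : ℂ)⁻¹ • ∮ w in C(c, r), resolvent a w

/-- The Cauchy transform `(2πi)⁻¹ ∮ (w - μ)⁻¹ (w - a)⁻¹ dw` of the resolvent over a circle. -/
noncomputable def resolventCauchy (a : A) (c : ℂ) (r : ℝ) (μ : ℂ) : A :=
  (2 * Real.pi * Complex.I : ℂ)⁻¹ • ∮ w in C(c, r), (w - μ)⁻¹ • resolvent a w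

variable {a : A} {c : ℂ} {r : ℝ}

theorem continuousOn_resolvent {s : Set ℂ} (hs : s ⊆ resolventSet ℂ a) :
    ContinuousOn (resolvent a) s := fun _ hw =>
  (differentiableAt_resolvent (hs hw)).continuousAt.continuousWithinAt

theorem circleIntegrable_resolvent (hr : 0 < r) (hs : sphere c r ⊆ resolventSet ℂ a) :
    CircleIntegrable (resolvent a) c r :=
  (continuousOn_resolvent hs).circleIntegrable hr.le

theorem continuousOn_sub_inv {μ : ℂ} (hμ : dist μ c ≠ r) :
    ContinuousOn (fun w : ℂ => (w - μ)⁻¹) (sphere c r) := by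
  refine ContinuousOn.inv₀ (by fun_prop) fun w hw h => hμ ?_
  rw [← sub_eq_zero.1 h]
  exact hw

theorem circleIntegrable_cauchy (hr : 0 < r) (hs : sphere c r ⊆ resolventSet ℂ a) {μ : ℂ}
    (hμ : dist μ c ≠ r) : CircleIntegrable (fun w => (w - μ)⁻¹ • resolvent a w) c r :=
  ((continuousOn_sub_inv hμ).smul (continuousOn_resolvent hs)).circleIntegrable hr.le

theorem commute_rieszProjection (hr : 0 < r) (hs : sphere c r ⊆ resolventSet ℂ a) {x : A}
    (hx : Commute x a) : Commute x (rieszProjection a c r) :=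
  (commute_circleIntegral (circleIntegrable_resolvent hr hs)
    fun w => commute_resolvent hx w).smul_right _

theorem commute_resolventCauchy (hr : 0 < r) (hs : sphere c r ⊆ resolventSet ℂ a) {μ : ℂ}
    (hμ : dist μ c ≠ r) {x : A} (hx : Commute x a) : Commute x (resolventCauchy a c r μ) :=
  (commute_circleIntegral (circleIntegrable_cauchy hr hs hμ)
    fun w => (commute_resolvent hx w).smul_right _).smul_right _

theorem differentiableOn_resolventCauchy (hr : 0 < r) (hs : sphere c r ⊆ resolventSet ℂ a) :
    DifferentiableOn ℂ (resolventCauchy a c r) (ball c r) := by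
  lift r to NNReal using hr.le
  have h := (hasFPowerSeriesOn_cauchy_integral
    (circleIntegrable_resolvent hr hs) hr).differentiableOn
  rw [Metric.eball_coe] at h
  exact h

theorem sub_mul_resolventCauchy (hr : 0 < r) (hs : sphere c r ⊆ resolventSet ℂ a) {μ : ℂ}
    (hμ : dist μ c ≠ r) :
    (algebraMap ℂ A μ - a) * resolventCauchy a c r μ =
      ((2 * Real.pi * Complex.I : ℂ)⁻¹ * ∮ w in C(c, r), (w - μ)⁻¹) • (1 : A)
        - rieszProjection a c r := by
  have hi := circleIntegrable_cauchy hr hs hμ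
  have hc : CircleIntegrable (fun w => (w - μ)⁻¹ • (1 : A)) c r :=
    ((continuousOn_sub_inv hμ).smul continuousOn_const).circleIntegrable hr.le
  rw [resolventCauchy, rieszProjection, mul_smul_comm, mul_circleIntegral _ hi, mul_smul,
    ← smul_sub, ← circleIntegral.integral_smul_const,
    ← circleIntegral.integral_sub hc (circleIntegrable_resolvent hr hs)]
  congr 1
  refine circleIntegral.integral_congr hr.le fun w hw => ?_
  have hne : w - μ ≠ 0 := fun h => hμ (by rw [← sub_eq_zero.1 h]; exact hw)
  -- `(μ - a) (w - a)⁻¹ = 1 - (w - μ) (w - a)⁻¹`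
  have h1 : (algebraMap ℂ A μ - a) = (algebraMap ℂ A w - a) - (w - μ) • (1 : A) := by
    rw [sub_smul, ← Algebra.algebraMap_eq_smul_one, ← Algebra.algebraMap_eq_smul_one]
    abel
  rw [mul_smul_comm, h1, sub_mul, sub_mul_resolvent (hs hw), smul_one_mul, smul_sub, smul_smul,
    inv_mul_cancel₀ hne, one_smul]

theorem sub_mul_resolventCauchy_of_mem_ball (hr : 0 < r) (hs : sphere c r ⊆ resolventSet ℂ a)
    {μ : ℂ} (hμ : dist μ c < r) :
    (algebraMap ℂ A μ - a) * resolventCauchy a c r μ = 1 - rieszProjection a c r := by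
  rw [sub_mul_resolventCauchy hr hs hμ.ne, circleIntegral.integral_sub_inv_of_mem_ball hμ,
    inv_mul_cancel₀ Complex.two_pi_I_ne_zero, one_smul]

theorem sub_mul_resolventCauchy_of_lt_dist (hr : 0 < r) (hs : sphere c r ⊆ resolventSet ℂ a)
    {μ : ℂ} (hμ : r < dist μ c) :
    (algebraMap ℂ A μ - a) * resolventCauchy a c r μ = - rieszProjection a c r := by
  have h0 : (∮ w in C(c, r), (w - μ)⁻¹) = 0 := by
    have hne : ∀ w ∈ closedBall c r, w - μ ≠ 0 := fun w hw h => by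
      rw [sub_eq_zero.1 h, mem_closedBall] at hw
      exact absurd hw (not_le.2 hμ)
    refine Complex.circleIntegral_eq_zero_of_differentiable_on_off_countable hr.le
      Set.countable_empty (ContinuousOn.inv₀ (by fun_prop) hne) fun w hw => ?_
    exact DifferentiableAt.inv (by fun_prop) (hne w (ball_subset_closedBall hw.1))
  rw [sub_mul_resolventCauchy hr hs hμ.ne', h0, mul_zero, zero_smul, zero_sub]

theorem rieszProjection_eq_of_annulus {r₀ : ℝ} (h0 : 0 < r₀) (hle : r₀ ≤ r)
    (hs : closedBall c r \ ball c r₀ ⊆ resolventSet ℂ a) :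
    rieszProjection a c r = rieszProjection a c r₀ := by
  rw [rieszProjection, rieszProjection,
    Complex.circleIntegral_eq_of_differentiable_on_annulus_off_countable h0 hle
      Set.countable_empty (continuousOn_resolvent hs) fun w hw => ?_]
  exact differentiableAt_resolvent
    (hs ⟨ball_subset_closedBall hw.1.1, fun h => hw.1.2 (ball_subset_closedBall h)⟩)

/-- On the smaller circle of an annulus in the resolvent set, the Cauchy transform taken over the
larger circle is `(w - a)⁻¹ (1 - p)`; it is holomorphic inside the larger circle, so its integral
`p (1 - p)` vanishes. -/
theorem isIdempotentElem_rieszProjection {r₀ : ℝ} (h0 : 0 < r₀) (hlt : r₀ < r)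
    (hs : closedBall c r \ ball c r₀ ⊆ resolventSet ℂ a) :
    IsIdempotentElem (rieszProjection a c r) := by
  have hr : 0 < r := h0.trans hlt
  have hs₁ : sphere c r ⊆ resolventSet ℂ a := fun w hw => hs
    ⟨sphere_subset_closedBall hw, fun h => absurd (mem_ball.1 h) (by rw [mem_sphere.1 hw]; linarith)⟩
  have hs₀ : sphere c r₀ ⊆ resolventSet ℂ a := fun w hw => hs
    ⟨mem_closedBall.2 (by rw [mem_sphere.1 hw]; exact hlt.le),
      fun h => absurd (mem_ball.1 h) (by rw [mem_sphere.1 hw]; exact lt_irrefl _)⟩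
  have hdiff : DifferentiableOn ℂ (resolventCauchy a c r) (ball c r) :=
    differentiableOn_resolventCauchy hr hs₁
  have hint : (∮ w in C(c, r₀), resolventCauchy a c r w) = 0 := by
    have hsub : closedBall c r₀ ⊆ ball c r := closedBall_subset_ball hlt
    refine Complex.circleIntegral_eq_zero_of_differentiable_on_off_countable h0.le
      Set.countable_empty (hdiff.continuousOn.mono hsub) fun w hw => ?_
    exact hdiff.differentiableAt (isOpen_ball.mem_nhds (hsub (ball_subset_closedBall hw.1)))
  have hkey : rieszProjection a c r₀ * (1 - rieszProjection a c r) = 0 := by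
    have : (∮ w in C(c, r₀), resolventCauchy a c r w) =
        ∮ w in C(c, r₀), resolvent a w * (1 - rieszProjection a c r) := by
      refine circleIntegral.integral_congr h0.le fun w hw => ?_
      have hw' : dist w c < r := by rw [mem_sphere.1 hw]; exact hlt
      rw [← sub_mul_resolventCauchy_of_mem_ball hr hs₁ hw', ← mul_assoc,
        resolvent_mul_sub (hs₀ hw), one_mul]
    rw [rieszProjection, smul_mul_assoc,
      circleIntegral_mul _ (circleIntegrable_resolvent h0 hs₀), ← this, hint, smul_zero]
  rw [← rieszProjection_eq_of_annulus h0 hlt.le hs, mul_sub, mul_one, sub_eq_zero] at hkey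
  exact hkey.symm

end RieszProjection

/-! ### Spectral splittings at isolated points of the spectrum -/

section SpectralSplitting

variable {A : Type*} [NormedRing A] [NormedAlgebra ℂ A]

/-- `IsSpectralSplitting a z p b` says that the idempotent `p` commutes with `a` and splits
`a - z` into a quasi-nilpotent part and an invertible part: `(a - z) p` has no nonzero spectrum,
and `b` is an inverse of `a - z` in the corner `(1 - p) A (1 - p)`.
Quasi-nilpotency is expressed through invertibility of `μ - (a - z) p` for `μ ≠ 0`. -/
structure IsSpectralSplitting (a : A) (z : ℂ) (p b : A) : Prop where
  idem : IsIdempotentElem p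
  comm : Commute p a
  sub_mul : (a - algebraMap ℂ A z) * b = 1 - p
  mul_sub : b * (a - algebraMap ℂ A z) = 1 - p
  mul_proj : b * p = 0
  proj_mul : p * b = 0
  isUnit : ∀ μ : ℂ, μ ≠ 0 → IsUnit (algebraMap ℂ A μ - (a - algebraMap ℂ A z) * p)

/-- An element `μ - x` that is invertible on the corner of the idempotent `p`, with inverse `-g p`,
becomes invertible when `x` is cut down to that corner. -/
theorem isUnit_sub_mul_idempotent {p x g : A} {μ : ℂ} (hμ : μ ≠ 0) (hp : IsIdempotentElem p)
    (hpx : Commute p x) (hgp : Commute g p) (hgx : Commute g x)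
    (h : (algebraMap ℂ A μ - x) * g = -p) : IsUnit (algebraMap ℂ A μ - x * p) := by
  set m : A := algebraMap ℂ A μ with hm
  set n : A := algebraMap ℂ A μ⁻¹ with hn
  have hmn : m * n = 1 := by rw [hm, hn, ← map_mul, mul_inv_cancel₀ hμ, map_one]
  have cm : ∀ y : A, Commute m y := fun y => Algebra.commute_algebraMap_left μ y
  have cn : ∀ y : A, Commute n y := fun y => Algebra.commute_algebraMap_left μ⁻¹ y
  have hp' : p * p = p := hp
  have hcomm : Commute (m - x * p) (n * (1 - p) - g * p) := by
    have h1 : Commute p (n * (1 - p) - g * p) :=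
      (((cn p).symm).mul_right ((Commute.one_right p).sub_right (Commute.refl p))).sub_right
        (hgp.symm.mul_right (Commute.refl p))
    have h2 : Commute x (n * (1 - p) - g * p) :=
      (((cn x).symm).mul_right ((Commute.one_right x).sub_right hpx.symm)).sub_right
        (hgx.symm.mul_right hpx.symm)
    exact (cm _).sub_left (h2.mul_left h1)
  have hone : (m - x * p) * (n * (1 - p) - g * p) = 1 := by
    have e1 : (m - x * p) * (1 - p) = m * (1 - p) := by
      simp only [_root_.mul_sub, _root_.sub_mul, mul_one, mul_assoc, hp']; abel
    have e2 : (m - x * p) * (g * p) = -p := by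
      rw [hgp.eq, ← mul_assoc, _root_.sub_mul, mul_assoc x p p, hp',
        ← _root_.sub_mul, mul_assoc, ← hgp.eq, ← mul_assoc, h, neg_mul, hp']
    rw [_root_.mul_sub, (cn (1 - p)).eq, ← mul_assoc, e1, e2, mul_assoc, ← (cn (1 - p)).eq,
      ← mul_assoc, hmn, one_mul]
    abel
  exact ⟨⟨_, _, hone, hcomm.eq ▸ hone⟩, rfl⟩

theorem eventually_mem_resolventSet_of_not_accPt {a : A} {z : ℂ}
    (h : ¬ AccPt z (𝓟 (spectrum ℂ a))) : ∀ᶠ w in 𝓝[≠] z, w ∈ resolventSet ℂ a := by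
  rw [accPt_iff_frequently, not_frequently] at h
  rw [eventually_nhdsWithin_iff]
  filter_upwards [h] with w hw hne
  by_contra hmem
  exact hw ⟨hne, hmem⟩

/-- A pole is recognized by meromorphy alone: the order at a point of the spectrum is negative,
because a limit of the resolvent at `z` would be an inverse of `z - a`. -/
theorem mem_poles_iff_meromorphicAt {a : A} {z : ℂ} (hz : z ∈ isoSpectrum a) :
    z ∈ poles a ↔ MeromorphicAt (resolvent a) z := by
  refine ⟨fun ⟨n, hn⟩ => hn.2.2.1, fun hm => ?_⟩
  have hneg : meromorphicOrderAt (resolvent a) z < 0 := by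
    by_contra hnot
    obtain ⟨c, hc⟩ := tendsto_nhds_of_meromorphicOrderAt_nonneg hm (not_lt.1 hnot)
    have hev := eventually_mem_resolventSet_of_not_accPt hz.2
    have ht : Tendsto (fun w : ℂ => algebraMap ℂ A w - a) (𝓝[≠] z) (𝓝 (algebraMap ℂ A z - a)) :=
      ((by fun_prop : Continuous fun w : ℂ => algebraMap ℂ A w - a).tendsto z).mono_left
        nhdsWithin_le_nhds
    have h1 : (algebraMap ℂ A z - a) * c = 1 :=
      tendsto_nhds_unique (ht.mul hc) (tendsto_const_nhds.congr'
        (hev.mono fun w hw => (sub_mul_resolvent hw).symm))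
    have h2 : c * (algebraMap ℂ A z - a) = 1 :=
      tendsto_nhds_unique (hc.mul ht) (tendsto_const_nhds.congr'
        (hev.mono fun w hw => (resolvent_mul_sub hw).symm))
    exact hz.1 ⟨⟨_, c, h1, h2⟩, rfl⟩
  obtain ⟨m, hm'⟩ := WithTop.ne_top_iff_exists.1 hneg.ne_top
  rw [← hm'] at hneg
  have hm0 : m < 0 := by exact_mod_cast hneg
  refine ⟨m.natAbs, hz, by omega, hm, ?_⟩
  rw [← hm']
  congr 1
  omega

theorem sub_mul_geom_sum (x : A) (μ : ℂ) (n : ℕ) :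
    (algebraMap ℂ A μ - x) * ∑ k ∈ Finset.range n, μ ^ k • x ^ (n - 1 - k) =
      μ ^ n • (1 : A) - x ^ n := by
  have h := (Algebra.commute_algebraMap_left (A := A) μ x).mul_geom_sum₂ n
  simp only [← map_pow, ← Algebra.smul_def] at h
  rw [h, Algebra.algebraMap_eq_smul_one]

/-- Multiplying the geometric sum identity by the resolvent. -/
theorem pow_smul_resolvent {x : A} {μ : ℂ} (hμ : IsUnit (algebraMap ℂ A μ - x)) (n : ℕ) :
    μ ^ n • resolvent x μ =
      (∑ k ∈ Finset.range n, μ ^ k • x ^ (n - 1 - k)) + x ^ n * resolvent x μ := by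
  have h := congrArg (resolvent x μ * ·) (sub_mul_geom_sum x μ n)
  have hc : Commute (x ^ n) (resolvent x μ) := commute_resolvent ((Commute.refl x).pow_left n) μ
  simp only [← mul_assoc, resolvent_mul_sub (show μ ∈ resolventSet ℂ x from hμ), one_mul,
    _root_.mul_sub, mul_smul_comm, mul_one] at h
  rw [h, hc.eq]
  abel

variable [CompleteSpace A]

theorem eventually_isUnit_one_sub_smul (b : A) : ∀ᶠ μ : ℂ in 𝓝 0, IsUnit (1 - μ • b) := by
  have hc : ContinuousAt (fun μ : ℂ => 1 - μ • b) 0 := by fun_prop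
  exact hc.eventually (by simpa [Filter.Eventually] using Units.isOpen.mem_nhds isUnit_one)

/-- If a punctured neighbourhood of `z` lies in the resolvent set, then the Riesz projection over a
small circle around `z` splits `a` at `z`. -/
theorem exists_isSpectralSplitting {a : A} {z : ℂ}
    (h : ∀ᶠ w in 𝓝[≠] z, w ∈ resolventSet ℂ a) : ∃ p b, IsSpectralSplitting a z p b := by
  obtain ⟨ε, hε, hball⟩ := Metric.eventually_nhds_iff.1 (eventually_nhdsWithin_iff.1 h)
  have hann : ∀ r₀ r : ℝ, 0 < r₀ → r < ε →
      Metric.closedBall z r \ Metric.ball z r₀ ⊆ resolventSet ℂ a := fun r₀ r h0 h1 w hw => by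
    refine hball (lt_of_le_of_lt hw.1 h1) fun hwz => hw.2 ?_
    rw [Set.mem_singleton_iff.1 hwz]
    exact Metric.mem_ball_self h0
  have hsph : ∀ r : ℝ, 0 < r → r < ε → Metric.sphere z r ⊆ resolventSet ℂ a :=
    fun r h0 h1 w hw => hann r r h0 h1 ⟨Metric.sphere_subset_closedBall hw, fun hb =>
      absurd (Metric.mem_ball.1 hb) (by rw [Metric.mem_sphere.1 hw]; exact lt_irrefl _)⟩
  set r : ℝ := ε / 2 with hr
  have hr0 : 0 < r := by positivity
  have hrε : r < ε := by rw [hr]; linarith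
  set p := rieszProjection a z r with hpdef
  have hp : IsIdempotentElem p :=
    isIdempotentElem_rieszProjection (half_pos hr0) (half_lt_self hr0) (hann _ _ (half_pos hr0) hrε)
  have hp' : p * p = p := hp
  have hpa : Commute p a := (commute_rieszProjection hr0 (hsph r hr0 hrε) (Commute.refl a)).symm
  have hz : dist z z < r := by rwa [dist_self]
  set g := resolventCauchy a z r z with hg
  have hga : Commute g a :=
    (commute_resolventCauchy hr0 (hsph r hr0 hrε) hz.ne (Commute.refl a)).symm
  have hgp : Commute g p := by
    refine (commute_resolventCauchy hr0 (hsph r hr0 hrε) hz.ne ?_).symm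
    exact hpa
  have hgz : (algebraMap ℂ A z - a) * g = 1 - p :=
    sub_mul_resolventCauchy_of_mem_ball hr0 (hsph r hr0 hrε) hz
  have hb : (a - algebraMap ℂ A z) * -(g * (1 - p)) = 1 - p := by
    rw [mul_neg, ← neg_mul, neg_sub, ← mul_assoc, hgz, hp.one_sub.eq]
  have hzc : ∀ y : A, Commute y (algebraMap ℂ A z) := fun y => Algebra.commute_algebraMap_right z y
  refine ⟨p, -(g * (1 - p)), hp, hpa, hb, ?_, ?_, ?_, fun μ hμ => ?_⟩
  · have h1 : Commute (g * (1 - p)) (a - algebraMap ℂ A z) :=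
      (hga.sub_right (hzc _)).mul_left
        (((Commute.one_left _).sub_left hpa).sub_right (hzc _))
    rw [h1.neg_left.eq, hb]
  · rw [neg_mul, mul_assoc, _root_.sub_mul, one_mul, hp', sub_self, mul_zero, neg_zero]
  · rw [mul_neg, ← mul_assoc, ← hgp.eq, mul_assoc, _root_.mul_sub, mul_one, hp', sub_self,
      mul_zero, neg_zero]
  · -- the projection does not depend on the radius, so the circle may be taken to leave `z + μ` out
    set s : ℝ := min r (‖μ‖ / 2) with hs
    have hs0 : 0 < s := lt_min hr0 (by positivity)
    have hsr : s ≤ r := min_le_left _ _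
    have hsμ : s < dist (z + μ) z := by
      rw [dist_eq_norm, add_sub_cancel_left]
      exact (min_le_right _ _).trans_lt (half_lt_self (norm_pos_iff.2 hμ))
    have hps : p = rieszProjection a z s :=
      rieszProjection_eq_of_annulus hs0 hsr (hann _ _ hs0 hrε)
    have hss := hsph s hs0 (hsr.trans_lt hrε)
    have hk := sub_mul_resolventCauchy_of_lt_dist hs0 hss hsμ
    rw [← hps, map_add] at hk
    have hka := (commute_resolventCauchy hs0 hss hsμ.ne' (Commute.refl a)).symm
    have hkp := (commute_resolventCauchy hs0 hss hsμ.ne' hpa).symm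
    refine isUnit_sub_mul_idempotent hμ hp (hpa.sub_right (hzc p)) hkp (hka.sub_right (hzc _)) ?_
    rw [← hk]
    congr 1
    abel

namespace IsSpectralSplitting

variable {a p b : A} {z : ℂ}

omit [CompleteSpace A]

theorem ne_zero (h : IsSpectralSplitting a z p b) (hz : z ∈ spectrum ℂ a) : p ≠ 0 := by
  rintro rfl
  apply hz
  rw [spectrum.mem_resolventSet_iff, ← neg_sub, IsUnit.neg_iff]
  exact ⟨⟨_, b, by simpa using h.sub_mul, by simpa using h.mul_sub⟩, rfl⟩

theorem comm_sub (h : IsSpectralSplitting a z p b) : Commute p (a - algebraMap ℂ A z) :=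
  h.comm.sub_right (Algebra.commute_algebraMap_right z p)

theorem mul_proj_pow (h : IsSpectralSplitting a z p b) (n : ℕ) :
    p * ((a - algebraMap ℂ A z) * p) ^ (n + 1) = ((a - algebraMap ℂ A z) * p) ^ (n + 1) := by
  have : p * ((a - algebraMap ℂ A z) * p) = (a - algebraMap ℂ A z) * p := by
    rw [← mul_assoc, h.comm_sub.eq, mul_assoc, h.idem.eq]
  rw [pow_succ', ← mul_assoc, this]

/-- The resolvent near `z` is the sum of the resolvents of its two parts. -/
theorem resolvent_eq (h : IsSpectralSplitting a z p b) {μ : ℂ} (hμ : μ ≠ 0)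
    (hb : IsUnit (1 - μ • b)) :
    z + μ ∈ resolventSet ℂ a ∧ resolvent a (z + μ) =
      p * resolvent ((a - algebraMap ℂ A z) * p) μ - b * Ring.inverse (1 - μ • b) := by
  set x := a - algebraMap ℂ A z with hx
  have hxa : algebraMap ℂ A (z + μ) - a = algebraMap ℂ A μ - x := by rw [map_add, hx]; abel
  obtain ⟨u, hu⟩ := h.isUnit μ hμ
  obtain ⟨v, hv⟩ := hb
  rw [← hx] at hu
  have hR : resolvent (x * p) μ = ↑u⁻¹ := by rw [resolvent, ← hu, Ring.inverse_unit]
  rw [hR, ← hv, Ring.inverse_unit]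
  have hpx : Commute p x := h.comm_sub
  have hp : p * p = p := h.idem
  have hm : ∀ y : A, Commute (algebraMap ℂ A μ) y := fun y => Algebra.commute_algebraMap_left μ y
  have hxb : Commute x b := by rw [Commute, SemiconjBy, hx, h.sub_mul, h.mul_sub]
  have hpu : Commute p (u : A) := by
    rw [hu]; exact ((hm p).symm).sub_right (hpx.mul_right (Commute.refl p))
  have hxu : Commute x (u : A) := by
    rw [hu]; exact ((hm x).symm).sub_right ((Commute.refl x).mul_right hpx.symm)
  have hbv : Commute b (v : A) := by
    rw [hv]; exact (Commute.one_right b).sub_right ((Commute.refl b).smul_right μ)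
  have hxv : Commute x (v : A) := by
    rw [hv]; exact (Commute.one_right x).sub_right (hxb.smul_right μ)
  have hone : (algebraMap ℂ A μ - x) * (p * ↑u⁻¹ - b * ↑v⁻¹) = 1 := by
    have e1 : (algebraMap ℂ A μ - x) * (p * ↑u⁻¹) = p := by
      have : (algebraMap ℂ A μ - x) * p = p * u := by
        rw [hu, _root_.mul_sub, _root_.sub_mul, (hm p).eq, ← mul_assoc, hpx.eq, mul_assoc x p p, hp]
      rw [← mul_assoc, this, mul_assoc, Units.mul_inv, mul_one]
    have e2 : (algebraMap ℂ A μ - x) * (b * ↑v⁻¹) = -(1 - p) := by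
      have : (algebraMap ℂ A μ - x) * b = -((1 - p) * v) := by
        rw [hv, _root_.sub_mul, h.sub_mul, ← Algebra.smul_def, _root_.mul_sub, mul_one,
          mul_smul_comm, _root_.sub_mul, h.proj_mul, one_mul, sub_zero]
        abel
      rw [← mul_assoc, this, neg_mul, mul_assoc, Units.mul_inv, mul_one]
    rw [_root_.mul_sub, e1, e2]
    abel
  have hcomm : Commute (algebraMap ℂ A μ - x) (p * ↑u⁻¹ - b * ↑v⁻¹) := by
    refine (hm _).sub_left (Commute.sub_right ?_ ?_)
    · exact hpx.symm.mul_right hxu.units_inv_right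
    · exact hxb.mul_right hxv.units_inv_right
  rw [resolvent, spectrum.mem_resolventSet_iff, hxa]
  set w : Aˣ := ⟨_, _, hone, hcomm.eq ▸ hone⟩ with hw
  have hw' : algebraMap ℂ A μ - x = w := rfl
  rw [hw', Ring.inverse_unit]
  exact ⟨w.isUnit, rfl⟩

theorem spectralRadius_eq_zero (h : IsSpectralSplitting a z p b) :
    spectralRadius ℂ ((a - algebraMap ℂ A z) * p) = 0 := by
  simp only [spectralRadius, ENNReal.iSup_eq_zero]
  intro μ hμ
  by_cases h0 : μ = 0
  · simp [h0]
  · exact absurd (h.isUnit μ h0) hμ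

variable [CompleteSpace A]

/-- Were `a - z` invertible, then `p = (a - z)⁻ⁿ ((a - z) p)ⁿ` for `n ≥ 1`; the norm of the right-hand
side tends to `0` by Gelfand's formula, since `(a - z) p` is quasi-nilpotent. -/
theorem mem_spectrum (h : IsSpectralSplitting a z p b) (hp : p ≠ 0) : z ∈ spectrum ℂ a := by
  intro hu
  rw [spectrum.mem_resolventSet_iff, ← neg_sub, IsUnit.neg_iff] at hu
  obtain ⟨u, hu⟩ := hu
  set x := a - algebraMap ℂ A z with hx
  have hpx : Commute p (u : A) := by rw [hu]; exact h.comm_sub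
  have hG := spectrum.pow_norm_pow_one_div_tendsto_nhds_spectralRadius (x * p)
  rw [h.spectralRadius_eq_zero] at hG
  set C : ℝ := ‖((u⁻¹ : Aˣ) : A)‖ + 1 with hC
  have hC0 : 0 < C := by positivity
  have hev : ∀ᶠ n : ℕ in atTop, ‖p‖ ≤ (1 / 2 : ℝ) ^ n := by
    have hlt : (0 : ENNReal) < ENNReal.ofReal (1 / (2 * C)) := ENNReal.ofReal_pos.2 (by positivity)
    filter_upwards [hG.eventually (gt_mem_nhds hlt), eventually_ge_atTop 1] with n hn hn1
    rw [ENNReal.ofReal_lt_ofReal_iff (by positivity)] at hn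
    have hn0 : (n : ℝ) ≠ 0 := by positivity
    have hpow : ‖(x * p) ^ n‖ ≤ (1 / (2 * C)) ^ n := by
      calc ‖(x * p) ^ n‖ = (‖(x * p) ^ n‖ ^ (1 / n : ℝ)) ^ n := by
            rw [← Real.rpow_natCast, ← Real.rpow_mul (norm_nonneg _), one_div,
              inv_mul_cancel₀ hn0, Real.rpow_one]
        _ ≤ _ := pow_le_pow_left₀ (by positivity) hn.le n
    have hpe : p = (((u⁻¹ : Aˣ) : A)) ^ n * (x * p) ^ n := by
      rw [← hu, hpx.symm.mul_pow, ← mul_assoc, ← Units.val_pow_eq_pow_val,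
        ← Units.val_pow_eq_pow_val, ← Units.val_mul, inv_pow, inv_mul_cancel, Units.val_one, one_mul,
        h.idem.pow_eq (by omega)]
    calc ‖p‖ = ‖(((u⁻¹ : Aˣ) : A)) ^ n * (x * p) ^ n‖ := by rw [← hpe]
      _ ≤ ‖(((u⁻¹ : Aˣ) : A)) ^ n‖ * ‖(x * p) ^ n‖ := norm_mul_le _ _
      _ ≤ C ^ n * (1 / (2 * C)) ^ n := by
          refine mul_le_mul ?_ hpow (norm_nonneg _) (by positivity)
          exact (norm_pow_le' _ (by omega)).trans
            (pow_le_pow_left₀ (norm_nonneg _) (by rw [hC]; linarith) n)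
      _ = (1 / 2) ^ n := by
          rw [← mul_pow]; congr 1; field_simp
  have h0 : Tendsto (fun n : ℕ => (1 / 2 : ℝ) ^ n) atTop (𝓝 0) :=
    tendsto_pow_atTop_nhds_zero_of_lt_one (by norm_num) (by norm_num)
  exact hp (norm_le_zero_iff.1 (ge_of_tendsto h0 hev))

theorem eventually_resolvent (h : IsSpectralSplitting a z p b) :
    ∀ᶠ w in 𝓝[≠] z, w ∈ resolventSet ℂ a ∧ resolvent a w =
      p * resolvent ((a - algebraMap ℂ A z) * p) (w - z) -
        b * Ring.inverse (1 - (w - z) • b) := by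
  have hc : Tendsto (fun w : ℂ => w - z) (𝓝 z) (𝓝 0) :=
    Continuous.tendsto' (by fun_prop) _ _ (sub_self z)
  rw [eventually_nhdsWithin_iff]
  filter_upwards [hc.eventually (eventually_isUnit_one_sub_smul b)] with w hw hne
  have := h.resolvent_eq (sub_ne_zero.2 hne) hw
  rwa [add_sub_cancel] at this

theorem mem_isoSpectrum (h : IsSpectralSplitting a z p b) (hp : p ≠ 0) : z ∈ isoSpectrum a := by
  refine ⟨h.mem_spectrum hp, ?_⟩
  rw [accPt_iff_frequently, not_frequently]
  filter_upwards [eventually_nhdsWithin_iff.1 h.eventually_resolvent] with w hw hw'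
  exact hw'.2 (hw hw'.1).1

theorem meromorphicAt_of_pow_eq_zero (h : IsSpectralSplitting a z p b) {n : ℕ}
    (hn : ((a - algebraMap ℂ A z) * p) ^ n = 0) : MeromorphicAt (resolvent a) z := by
  set y := (a - algebraMap ℂ A z) * p with hy
  have hb : AnalyticAt ℂ (fun w : ℂ => Ring.inverse (1 - (w - z) • b)) z := by
    have h1 : AnalyticAt ℂ (fun w : ℂ => 1 - (w - z) • b) z := by fun_prop
    refine AnalyticAt.fun_comp ?_ h1
    simpa using analyticAt_inverse (𝕜 := ℂ) (1 : Aˣ)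
  have hmer : MeromorphicAt (fun w : ℂ => (((w - z) ^ n)⁻¹ : ℂ) •
      (∑ k ∈ Finset.range n, (w - z) ^ k • (p * y ^ (n - 1 - k))) -
        b * Ring.inverse (1 - (w - z) • b)) z := by
    refine MeromorphicAt.fun_sub (MeromorphicAt.fun_smul ?_ ?_) ?_
    · exact (AnalyticAt.meromorphicAt (by fun_prop)).inv
    · exact AnalyticAt.meromorphicAt (by fun_prop)
    · exact (analyticAt_const.mul hb).meromorphicAt
  refine hmer.congr ?_
  filter_upwards [h.eventually_resolvent, self_mem_nhdsWithin] with w hw hne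
  have hne' : w - z ≠ 0 := sub_ne_zero.2 hne
  have hy' := pow_smul_resolvent (h.isUnit (w - z) hne') n
  rw [← hy, hn, zero_mul, add_zero] at hy'
  rw [hw.2]
  congr 1
  simp only [← mul_smul_comm, ← Finset.mul_sum]
  rw [← hy', smul_smul, inv_mul_cancel₀ (pow_ne_zero _ hne'), one_smul]

/-- If the resolvent of `a` has a pole of order `n` at `z`, then `μ ↦ yⁿ (μ - y)⁻¹`, with
`y = (a - z) p`, extends to an entire function vanishing at infinity, so it is zero by Liouville. -/
theorem pow_eq_zero_of_isPoleOfOrder (h : IsSpectralSplitting a z p b) {n : ℕ}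
    (hn : IsPoleOfOrder a z n) : ((a - algebraMap ℂ A z) * p) ^ n = 0 := by
  classical
  obtain ⟨-, hn1, hm, hord⟩ := hn
  obtain ⟨g, hg, -, hgR⟩ := (meromorphicOrderAt_eq_int_iff hm).1 hord
  set y := (a - algebraMap ℂ A z) * p with hy
  set G : ℂ → A := fun μ =>
    p * g (z + μ) - p * ∑ k ∈ Finset.range n, μ ^ k • y ^ (n - 1 - k) with hG
  have hGd : DifferentiableAt ℂ G 0 := by
    have h1 : DifferentiableAt ℂ (fun μ : ℂ => g (z + μ)) 0 :=
      DifferentiableAt.comp (f := fun μ : ℂ => z + μ) (0 : ℂ)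
        (by simpa using hg.differentiableAt) (by fun_prop)
    exact (h1.const_mul p).sub (by fun_prop)
  have hpy : p * y ^ n = y ^ n := by
    obtain ⟨m, rfl⟩ : ∃ m, n = m + 1 := ⟨n - 1, by omega⟩
    exact h.mul_proj_pow m
  have htr : Tendsto (fun μ : ℂ => z + μ) (𝓝 0) (𝓝 z) :=
    Continuous.tendsto' (by fun_prop) _ _ (add_zero z)
  have hGe : ∀ᶠ μ in 𝓝 (0 : ℂ), μ ≠ 0 → y ^ n * resolvent y μ = G μ := by
    filter_upwards [htr.eventually (eventually_nhdsWithin_iff.1 hgR),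
      eventually_isUnit_one_sub_smul b] with μ h1 h2 hμ
    have hR := h1 (by simpa using hμ)
    rw [(h.resolvent_eq hμ h2).2, add_sub_cancel_left, ← hy] at hR
    have hpR : p * resolvent y μ = μ ^ (-(n : ℤ)) • (p * g (z + μ)) := by
      rw [← mul_smul_comm, ← hR, _root_.mul_sub, ← mul_assoc, ← mul_assoc, h.idem.eq, h.proj_mul,
        zero_mul, sub_zero]
    have hgeom := pow_smul_resolvent (h.isUnit μ hμ) n
    rw [← hy] at hgeom
    have : p * g (z + μ) = p * (μ ^ n • resolvent y μ) := by
      rw [mul_smul_comm, hpR, smul_smul, zpow_neg, zpow_natCast,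
        mul_inv_cancel₀ (pow_ne_zero _ hμ), one_smul]
    simp only [hG]
    rw [this, hgeom, mul_add, add_sub_cancel_left, ← mul_assoc, hpy]
  set F : ℂ → A := Function.update (fun μ => y ^ n * resolvent y μ) 0 (G 0) with hF
  have hFd : Differentiable ℂ F := by
    intro μ
    by_cases hμ : μ = 0
    · rw [hμ]
      refine hGd.congr_of_eventuallyEq ?_
      filter_upwards [hGe] with ν hν
      by_cases h0 : ν = 0
      · rw [h0, hF, Function.update_self]
      · rw [hF, Function.update_of_ne h0, hν h0]
    · have hd : DifferentiableAt ℂ (fun μ => y ^ n * resolvent y μ) μ :=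
        (differentiableAt_resolvent (h.isUnit μ hμ)).const_mul _
      refine hd.congr_of_eventuallyEq ?_
      filter_upwards [isOpen_ne.mem_nhds hμ] with ν hν
      rw [hF, Function.update_of_ne hν]
  have hF0 : Tendsto F (cocompact ℂ) (𝓝 0) := by
    rw [← Metric.cobounded_eq_cocompact]
    have h1 : Tendsto (fun μ => y ^ n * resolvent y μ) (Bornology.cobounded ℂ) (𝓝 0) := by
      simpa using (spectrum.resolvent_tendsto_cobounded (𝕜 := ℂ) y).const_mul (y ^ n)
    refine h1.congr' ?_
    filter_upwards [Bornology.eventually_ne_cobounded (0 : ℂ)] with μ hμ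
    rw [hF, Function.update_of_ne hμ]
  have hz := hFd.apply_eq_of_tendsto_cocompact 1 hF0
  rw [hF, Function.update_of_ne one_ne_zero] at hz
  have h2 := congrArg (· * (algebraMap ℂ A 1 - y)) hz
  simpa only [mul_assoc, resolvent_mul_sub (show (1 : ℂ) ∈ resolventSet ℂ y from
    h.isUnit 1 one_ne_zero), mul_one, zero_mul] using h2

theorem mem_poles_iff (h : IsSpectralSplitting a z p b) (hp : p ≠ 0) :
    z ∈ poles a ↔ ∃ n, 1 ≤ n ∧ ((a - algebraMap ℂ A z) * p) ^ n = 0 := by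
  refine ⟨fun ⟨n, hn⟩ => ⟨n, hn.2.1, h.pow_eq_zero_of_isPoleOfOrder hn⟩, fun ⟨n, _, hn⟩ => ?_⟩
  exact (mem_poles_iff_meromorphicAt (h.mem_isoSpectrum hp)).2 (h.meromorphicAt_of_pow_eq_zero hn)

end IsSpectralSplitting

end SpectralSplitting

/-! ### The spectrum of a compact operator -/

section CompactSpectrum

open Module.End

variable {X : Type*} [NormedAddCommGroup X] [NormedSpace ℂ X]

/-- An infinite family of eigenvectors `x n` for distinct eigenvalues of modulus at least `ε`
yields, by Riesz's lemma applied along the flag `span {x i | i < n}`, a bounded sequence whose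
image under the operator is `ε`-separated. -/
theorem finite_spectrum_inter_le_norm [CompleteSpace X] {K : X →L[ℂ] X} (hK : IsCompactOperator K)
    {ε : ℝ} (hε : 0 < ε) : {μ ∈ spectrum ℂ K | ε ≤ ‖μ‖}.Finite := by
  by_contra hinf
  set μ : ℕ → ℂ := fun n => (Set.Infinite.natEmbedding _ hinf n : ℂ) with hμdef
  have hμinj : Function.Injective μ :=
    Subtype.val_injective.comp (Set.Infinite.natEmbedding _ hinf).injective
  have hμmem : ∀ n, μ n ∈ spectrum ℂ K ∧ ε ≤ ‖μ n‖ :=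
    fun n => (Set.Infinite.natEmbedding _ hinf n).2
  have hμ0 : ∀ n, μ n ≠ 0 := fun n => norm_pos_iff.1 (hε.trans_le (hμmem n).2)
  have hev : ∀ n, ∃ x, HasEigenvector (K : Module.End ℂ X) (μ n) x := fun n =>
    ((hK.hasEigenvalue_iff_mem_spectrum (hμ0 n)).2 (hμmem n).1).exists_hasEigenvector
  choose x hx using hev
  have hli : LinearIndependent ℂ x := eigenvectors_linearIndependent' _ μ hμinj x hx
  set V : ℕ → Submodule ℂ X := fun n => Submodule.span ℂ (x '' Set.Iio n) with hV
  have hVmono : Monotone V := fun m n hmn =>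
    Submodule.span_mono (Set.image_mono (Set.Iio_subset_Iio hmn))
  have hxV : ∀ {i n : ℕ}, i < n → x i ∈ V n := fun {i n} hin =>
    Submodule.subset_span ⟨i, hin, rfl⟩
  have hVclosed : ∀ n, IsClosed (V n : Set X) := fun n => by
    have : FiniteDimensional ℂ (V n) :=
      FiniteDimensional.span_of_finite ℂ ((Set.finite_Iio n).image x)
    exact Submodule.closed_of_finiteDimensional _
  have hKx : ∀ n, K (x n) = μ n • x n := fun n => (hx n).apply_eq_smul
  -- `K - μ n` maps the subspace `V (n + 1)` into `V n`
  have hstep : ∀ n, ∀ v ∈ V (n + 1), K v - μ n • v ∈ V n := by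
    intro n
    have hle : V (n + 1) ≤ (V n).comap ((K - μ n • 1 : X →L[ℂ] X) : X →ₗ[ℂ] X) := by
      refine Submodule.span_le.2 ?_
      rintro _ ⟨i, hi, rfl⟩
      have hi' : i ≤ n := Nat.lt_succ_iff.1 hi
      have : (K - μ n • 1 : X →L[ℂ] X) (x i) = (μ i - μ n) • x i := by
        simp [hKx, sub_smul]
      simp only [SetLike.mem_coe, Submodule.mem_comap, ContinuousLinearMap.coe_coe, this]
      rcases hi'.eq_or_lt with rfl | hlt
      · simp
      · exact Submodule.smul_mem _ _ (hxV hlt)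
    intro v hv
    simpa using hle hv
  have hmap : ∀ n, ∀ v ∈ V n, K v ∈ V n := fun n v hv => by
    have h1 := hstep n v (hVmono n.le_succ hv)
    simpa using (V n).add_mem h1 ((V n).smul_mem (μ n) hv)
  have hriesz : ∀ n, ∃ y ∈ V (n + 1), ‖y‖ ≤ 3 ∧ ∀ u ∈ V n, 1 ≤ ‖y - u‖ := by
    intro n
    obtain ⟨y, hy, hyu⟩ := riesz_lemma_of_norm_lt (𝕜 := ℂ) (c := 2) (by norm_num) (R := 3)
      (by norm_num) (F := (V n).comap (V (n + 1)).subtype)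
      ((hVclosed n).preimage continuous_subtype_val)
      ⟨⟨x n, hxV n.lt_succ_self⟩, fun hmem =>
        hli.notMem_span_image (s := Set.Iio n) (x := n) (by simp) hmem⟩
    exact ⟨y, y.2, hy, fun u hu => hyu ⟨u, hVmono n.le_succ hu⟩ hu⟩
  choose y hyV hy3 hyu using hriesz
  have hlt : ∀ m n, m < n → ε ≤ ‖K (y n) - K (y m)‖ := by
    intro m n hmn
    have hyV' : y m ∈ V n := hVmono (Nat.succ_le_of_lt hmn) (hyV m)
    have hu : (μ n)⁻¹ • (K (y m) - (K (y n) - μ n • y n)) ∈ V n :=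
      (V n).smul_mem _ ((V n).sub_mem (hmap n _ hyV') (hstep n _ (hyV n)))
    have heq : K (y n) - K (y m) =
        μ n • (y n - (μ n)⁻¹ • (K (y m) - (K (y n) - μ n • y n))) := by
      rw [smul_sub, smul_inv_smul₀ (hμ0 n)]; abel
    rw [heq, norm_smul]
    calc ε ≤ ‖μ n‖ * 1 := by rw [mul_one]; exact (hμmem n).2
      _ ≤ _ := mul_le_mul_of_nonneg_left (hyu n _ hu) (norm_nonneg _)
  obtain ⟨S, hS, hS'⟩ := hK.image_closedBall_subset_compact (3 : ℝ)
  obtain ⟨w, -, ψ, hψ, hψw⟩ := hS.tendsto_subseq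
    (fun n => hS' ⟨y n, by simpa using hy3 n, rfl⟩)
  obtain ⟨N, hN⟩ := Metric.cauchySeq_iff'.1 hψw.cauchySeq ε hε
  have h1 := hN (N + 1) N.le_succ
  rw [dist_eq_norm] at h1
  exact absurd (hlt _ _ (hψ N.lt_succ_self)) (not_le.2 h1)

theorem countable_spectrum [CompleteSpace X] {K : X →L[ℂ] X} (hK : IsCompactOperator K) :
    (spectrum ℂ K).Countable := by
  have hsub : spectrum ℂ K ⊆
      {0} ∪ ⋃ n : ℕ, {μ ∈ spectrum ℂ K | (1 : ℝ) / (n + 1) ≤ ‖μ‖} := by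
    intro μ hμ
    by_cases h0 : μ = 0
    · exact Or.inl h0
    · obtain ⟨n, hn⟩ := exists_nat_one_div_lt (norm_pos_iff.2 h0)
      exact Or.inr (Set.mem_iUnion.2 ⟨n, hμ, hn.le⟩)
  refine Set.Countable.mono hsub ((Set.countable_singleton 0).union
    (Set.countable_iUnion fun n => ?_))
  exact (finite_spectrum_inter_le_norm hK (by positivity)).countable

theorem finiteDimensional_range_of_isCompactOperator {q : X →L[ℂ] X} (hq : IsIdempotentElem q)
    (hc : IsCompactOperator q) : FiniteDimensional ℂ q.range := by
  have h1 : IsCompactOperator (Set.codRestrict q (q.range : Set X) fun x => ⟨x, rfl⟩) :=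
    hc.codRestrict (V := q.range) (fun x => ⟨x, rfl⟩)
      (ContinuousLinearMap.IsIdempotentElem.isClosed_range hq)
  have h2 := h1.comp_clm q.range.subtypeL
  refine FiniteDimensional.of_isCompactOperator_id (𝕜 := ℂ) ?_
  have hid : (id : q.range → q.range) =
      Set.codRestrict q (q.range : Set X) (fun x => ⟨x, rfl⟩) ∘ q.range.subtypeL := by
    funext ⟨x, hx⟩
    obtain ⟨u, rfl⟩ := hx
    exact Subtype.ext (congrArg (· u) hq.eq).symm
  rw [hid]
  exact h2

theorem isCompactOperator_of_hasFiniteRange {f : X →L[ℂ] X}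
    (hf : (f : X →ₗ[ℂ] X).HasFiniteRange) : IsCompactOperator f := by
  have : FiniteDimensional ℂ (f : X →ₗ[ℂ] X).range := Module.Finite.of_fg hf
  have : ProperSpace (f : X →ₗ[ℂ] X).range := FiniteDimensional.proper ℂ _
  exact ((isCompactOperator_id (E := (f : X →ₗ[ℂ] X).range)).comp_clm
    (f.codRestrict (f : X →ₗ[ℂ] X).range fun x => ⟨x, rfl⟩)).clm_comp
      (f : X →ₗ[ℂ] X).range.subtypeL

open scoped LinearMap.FiniteRangeSetoid in
/-- The spectral splitting of the compact operator `K` at `1` has a compact, hence finite rank,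
projection, so that the inverse on the complementary corner is a quasi-inverse of `1 - K`. -/
theorem exists_isQuasiInverse_one_sub [CompleteSpace X] {K : X →L[ℂ] X}
    (hK : IsCompactOperator K) : ∃ v : X →L[ℂ] X, v.IsQuasiInverse (1 - K : X →L[ℂ] X) := by
  have hres : ∀ᶠ w in 𝓝[≠] (1 : ℂ), w ∈ resolventSet ℂ K := by
    have hfin := finite_spectrum_inter_le_norm hK (ε := 1 / 2) (by norm_num)
    rw [eventually_nhdsWithin_iff]
    have h1 : ∀ᶠ w in 𝓝 (1 : ℂ), (1 / 2 : ℝ) < ‖w‖ :=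
      continuous_norm.continuousAt.eventually (lt_mem_nhds (by norm_num))
    have h2 := (hfin.subset (Set.sdiff_subset (t := {1}))).isClosed.isOpen_compl.mem_nhds
      (show (1 : ℂ) ∈ ({μ ∈ spectrum ℂ K | (1 / 2 : ℝ) ≤ ‖μ‖} \ {1})ᶜ by simp)
    filter_upwards [h1, h2] with w hw1 hw2 hne
    by_contra hmem
    exact hw2 ⟨⟨hmem, hw1.le⟩, hne⟩
  obtain ⟨q, b, h⟩ := exists_isSpectralSplitting hres
  have hcq : IsCompactOperator q := by
    obtain ⟨u, hu⟩ := h.isUnit (-1) (by norm_num)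
    -- `K q = q + (K - 1) q = -q u`
    have hqu : K * q = -(q * u) := by
      have hpow := h.mul_proj_pow 0
      simp only [zero_add, pow_one] at hpow
      rw [hu, mul_sub, hpow]
      simp [sub_mul]
    have hq : q = -(K * q) * (u⁻¹ : (X →L[ℂ] X)ˣ) := by
      rw [hqu, neg_neg, mul_assoc, Units.mul_inv, mul_one]
    rw [hq]
    exact ((hK.comp_clm q).neg).comp_clm (u⁻¹ : (X →L[ℂ] X)ˣ).val
  have hfd := finiteDimensional_range_of_isCompactOperator h.idem hcq
  have hfr : (q : X →ₗ[ℂ] X).HasFiniteRange := Module.Finite.iff_fg.1 hfd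
  have e1 : (1 - K) * -b = 1 - q := by rw [← h.sub_mul]; simp; noncomm_ring
  have e2 : -b * (1 - K) = 1 - q := by rw [← h.mul_sub]; simp; noncomm_ring
  have e3 : (LinearMap.id : X →ₗ[ℂ] X) - ((1 - q : X →L[ℂ] X) : X →ₗ[ℂ] X) = q := by ext x; simp
  refine ⟨-b, ?_, ?_⟩
  · change ((-b * (1 - K) : X →L[ℂ] X) : X →ₗ[ℂ] X) ≈ LinearMap.id
    rw [e2, Setoid.comm, LinearMap.FiniteRangeSetoid.equiv_iff_hasFiniteRange, e3]
    exact hfr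
  · change (((1 - K) * -b : X →L[ℂ] X) : X →ₗ[ℂ] X) ≈ LinearMap.id
    rw [e1, Setoid.comm, LinearMap.FiniteRangeSetoid.equiv_iff_hasFiniteRange, e3]
    exact hfr

end CompactSpectrum

/-! ### Atkinson's theorem and lifting of idempotents from the Calkin algebra -/

section Calkin

variable {X : Type*} [NormedAddCommGroup X] [NormedSpace ℂ X]

theorem calkinMk_eq_iff {U V : X →L[ℂ] X} :
    calkinMk X U = calkinMk X V ↔ IsCompactOperator (U - V : X →L[ℂ] X) :=
  Ideal.Quotient.eq

theorem calkinMk_eq_zero_iff {U : X →L[ℂ] X} : calkinMk X U = 0 ↔ IsCompactOperator U :=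
  Ideal.Quotient.eq_zero_iff_mem

theorem calkinMk_surjective : Function.Surjective (calkinMk X) :=
  Ideal.Quotient.mk_surjective

theorem isUnit_calkinMk_iff {U : X →L[ℂ] X} : IsUnit (calkinMk X U) ↔
    ∃ V, calkinMk X (U * V) = 1 ∧ calkinMk X (V * U) = 1 := by
  constructor
  · rintro ⟨u, hu⟩
    obtain ⟨V, hV⟩ := calkinMk_surjective (X := X) ↑u⁻¹
    exact ⟨V, by rw [map_mul, hV, ← hu, Units.mul_inv], by rw [map_mul, hV, ← hu, Units.inv_mul]⟩
  · rintro ⟨V, h1, h2⟩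
    exact ⟨⟨_, calkinMk X V, by rw [← map_mul, h1], by rw [← map_mul, h2]⟩, rfl⟩

open scoped LinearMap.FiniteRangeSetoid in
/-- **Atkinson's theorem**: an operator is Fredholm if and only if it is invertible modulo the
compact operators. -/
theorem isFredholm_iff_isUnit_calkinMk [CompleteSpace X] {U : X →L[ℂ] X} :
    U.IsFredholm ↔ IsUnit (calkinMk X U) := by
  rw [ContinuousLinearMap.isFredholm_iff_exists_isQuasiInverse, isUnit_calkinMk_iff]
  constructor
  · rintro ⟨V, h1, h2⟩
    have h1' := LinearMap.FiniteRangeSetoid.equiv_iff_hasFiniteRange.1 h1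
    have h2' := LinearMap.FiniteRangeSetoid.equiv_iff_hasFiniteRange.1 h2
    refine ⟨V, ?_, ?_⟩
    · rw [← map_one (calkinMk X), calkinMk_eq_iff]
      exact isCompactOperator_of_hasFiniteRange (f := U * V - 1) h2'
    · rw [← map_one (calkinMk X), calkinMk_eq_iff]
      exact isCompactOperator_of_hasFiniteRange (f := V * U - 1) h1'
  · rintro ⟨V, h1, h2⟩
    rw [← map_one (calkinMk X), eq_comm, calkinMk_eq_iff] at h1 h2
    obtain ⟨w₁, hw₁, -⟩ := exists_isQuasiInverse_one_sub h2
    obtain ⟨w₂, -, hw₂⟩ := exists_isQuasiInverse_one_sub h1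
    rw [sub_sub_cancel] at hw₁ hw₂
    set u := U.toLinearMap
    set v := V.toLinearMap
    set a := w₁.toLinearMap
    set b := w₂.toLinearMap
    replace hw₁ : a ∘ₗ (v ∘ₗ u) ≈ LinearMap.id := hw₁
    replace hw₂ : (u ∘ₗ v) ∘ₗ b ≈ LinearMap.id := hw₂
    -- a left and a right quasi-inverse agree modulo finite rank
    have hab : a ∘ₗ v ≈ v ∘ₗ b := calc
      a ∘ₗ v = (a ∘ₗ v) ∘ₗ LinearMap.id := rfl
      _ ≈ (a ∘ₗ v) ∘ₗ ((u ∘ₗ v) ∘ₗ b) := by grw [hw₂]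
      _ = (a ∘ₗ (v ∘ₗ u)) ∘ₗ (v ∘ₗ b) := rfl
      _ ≈ LinearMap.id ∘ₗ (v ∘ₗ b) := by grw [hw₁]
      _ = v ∘ₗ b := rfl
    refine ⟨w₁ * V, hw₁, ?_⟩
    change u ∘ₗ (a ∘ₗ v) ≈ LinearMap.id
    calc u ∘ₗ (a ∘ₗ v) ≈ u ∘ₗ (v ∘ₗ b) := by grw [hab]
      _ ≈ LinearMap.id := hw₂

theorem countable_preimage_sub_sq {s : Set ℂ} (hs : s.Countable) :
    ((fun μ : ℂ => μ - μ ^ 2) ⁻¹' s).Countable := by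
  rw [← Set.biUnion_preimage_singleton]
  refine hs.biUnion fun ν _ => ?_
  rcases Set.eq_empty_or_nonempty ((fun μ : ℂ => μ - μ ^ 2) ⁻¹' {ν}) with h | ⟨μ₀, h₀⟩
  · rw [h]; exact Set.countable_empty
  · refine Set.Countable.mono (s₂ := {μ₀, 1 - μ₀}) (fun μ hμ => ?_) (Set.to_countable _)
    have h0 : (μ - μ₀) * (μ - (1 - μ₀)) = 0 := by
      simp only [Set.mem_preimage, Set.mem_singleton_iff] at h₀ hμ
      linear_combination h₀ - hμ
    rcases mul_eq_zero.1 h0 with h | h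
    · exact Or.inl (sub_eq_zero.1 h)
    · exact Or.inr (sub_eq_zero.1 h)

/-- Idempotents lift from the Calkin algebra. A lift `Q` of the idempotent has `Q - Q²` compact,
so its spectrum is countable, and some circle around `1` of radius less than `1` avoids it; the
Riesz projection of `Q` over that circle is the required idempotent. -/
theorem exists_isIdempotentElem_calkinMk_eq [CompleteSpace X] {p : Calkin X}
    (hp : IsIdempotentElem p) : ∃ P : X →L[ℂ] X, IsIdempotentElem P ∧ calkinMk X P = p := by
  obtain ⟨Q, hQ⟩ := calkinMk_surjective p
  have hp' : p * p = p := hp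
  have hK : IsCompactOperator (Q - Q ^ 2 : X →L[ℂ] X) := by
    rw [← calkinMk_eq_iff, map_pow, hQ, hp.pow_eq two_ne_zero]
  have hcount : (spectrum ℂ Q).Countable := by
    refine (countable_preimage_sub_sq (countable_spectrum hK)).mono fun μ hμ => ?_
    have h := spectrum.subset_polynomial_aeval Q (Polynomial.X - Polynomial.X ^ 2)
      (Set.mem_image_of_mem _ hμ)
    simpa using h
  set D : Set ℝ := (fun w : ℂ => dist w 1) '' spectrum ℂ Q with hD
  have hDcl : IsClosed D := ((spectrum.isCompact Q).image (by fun_prop)).isClosed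
  obtain ⟨r, hrD, hr0, hr1⟩ :=
    ((hcount.image _).dense_compl ℝ : Dense Dᶜ).exists_between (zero_lt_one (α := ℝ))
  obtain ⟨δ, hδ, hball⟩ := Metric.isOpen_iff.1 hDcl.isOpen_compl r hrD
  set r₀ : ℝ := max (r / 2) (r - δ / 2) with hr₀
  have hr₀0 : 0 < r₀ := lt_max_of_lt_left (by positivity)
  have hr₀r : r₀ < r := max_lt (by linarith) (by linarith)
  have hann : Metric.closedBall (1 : ℂ) r \ Metric.ball 1 r₀ ⊆ resolventSet ℂ Q := by
    intro w hw
    by_contra hmem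
    have h1 : dist w 1 ≤ r := hw.1
    have h2 : r₀ ≤ dist w 1 := not_lt.1 hw.2
    have h3 : r - δ / 2 ≤ r₀ := le_max_right _ _
    refine hball ?_ ⟨w, hmem, rfl⟩
    rw [Metric.mem_ball, Real.dist_eq, abs_lt]
    constructor <;> linarith
  have hs : Metric.sphere (1 : ℂ) r ⊆ resolventSet ℂ Q := fun w hw => hann
    ⟨Metric.sphere_subset_closedBall hw, fun h => absurd (Metric.mem_ball.1 h)
      (by rw [Metric.mem_sphere.1 hw]; linarith)⟩
  refine ⟨rieszProjection Q 1 r, isIdempotentElem_rieszProjection hr₀0 hr₀r hann, ?_⟩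
  have h1 := congrArg (calkinMk X) (sub_mul_resolventCauchy_of_mem_ball (μ := 1) hr0 hs
    (by rwa [dist_self]))
  have h0 := congrArg (calkinMk X) (sub_mul_resolventCauchy_of_lt_dist (μ := 0) hr0 hs
    (by simpa using hr1))
  simp only [map_mul, map_sub, map_neg, map_one, map_zero, zero_sub, hQ] at h0 h1
  set P := calkinMk X (rieszProjection Q 1 r)
  -- the points `0` and `1` lie outside and inside the circle
  have e1 : p = p * P := by
    have := congrArg (p * ·) h1
    simp only [← mul_assoc, mul_sub, mul_one, hp', sub_self, zero_mul] at this
    exact sub_eq_zero.1 this.symm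
  have e0 : P = p * P := by
    have := congrArg ((1 - p) * ·) h0
    simp only [← mul_assoc, sub_mul, mul_neg, neg_mul, one_mul, hp', sub_self, zero_mul, neg_zero]
      at this
    exact sub_eq_zero.1 (neg_eq_zero.1 this.symm)
  rw [e0, ← e1]

end Calkin

/-! ### Compressions and dilations along a complemented subspace -/

section Corner

variable {X Y : Type*} [NormedAddCommGroup X] [NormedSpace ℂ X]
  [NormedAddCommGroup Y] [NormedSpace ℂ Y]

/-- The compression `κ U ι` to `Y` of an operator `U` on `X`, where `ι : Y → X` is an inclusion and
`κ : X → Y` a projection. -/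
def compress (κ : X →L[ℂ] Y) (ι : Y →L[ℂ] X) (U : X →L[ℂ] X) : Y →L[ℂ] Y := κ ∘L U ∘L ι

/-- The operator `ι W κ` on `X` that acts as `W` on the image of `ι` and vanishes on the kernel
of `κ`. -/
def dilate (ι : Y →L[ℂ] X) (κ : X →L[ℂ] Y) (W : Y →L[ℂ] Y) : X →L[ℂ] X := ι ∘L W ∘L κ

variable {ι : Y →L[ℂ] X} {κ : X →L[ℂ] Y}

theorem isCompactOperator_compress {U : X →L[ℂ] X} (hU : IsCompactOperator U) :
    IsCompactOperator (compress κ ι U) := (hU.comp_clm ι).clm_comp κ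

theorem isCompactOperator_dilate {W : Y →L[ℂ] Y} (hW : IsCompactOperator W) :
    IsCompactOperator (dilate ι κ W) := (hW.comp_clm κ).clm_comp ι

theorem compress_dilate (h : κ ∘L ι = .id ℂ Y) (W : Y →L[ℂ] Y) :
    compress κ ι (dilate ι κ W) = W := by
  have h' : ∀ y, κ (ι y) = y := fun y => congrArg (· y) h
  ext y
  simp [compress, dilate, h']

theorem compress_one (h : κ ∘L ι = .id ℂ Y) : compress κ ι 1 = 1 := h

theorem compress_sub (U V : X →L[ℂ] X) :
    compress κ ι (U - V) = compress κ ι U - compress κ ι V := by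
  ext y; simp [compress]

theorem compress_algebraMap (h : κ ∘L ι = .id ℂ Y) (μ : ℂ) :
    compress κ ι (algebraMap ℂ _ μ) = algebraMap ℂ _ μ := by
  have h' : ∀ y, κ (ι y) = y := fun y => congrArg (· y) h
  ext y
  simp [compress, Algebra.algebraMap_eq_smul_one, h']

theorem dilate_sub (V W : Y →L[ℂ] Y) : dilate ι κ (V - W) = dilate ι κ V - dilate ι κ W := by
  ext x; simp [dilate]

theorem dilate_mul (h : κ ∘L ι = .id ℂ Y) (V W : Y →L[ℂ] Y) :
    dilate ι κ (V * W) = dilate ι κ V * dilate ι κ W := by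
  have h' : ∀ y, κ (ι y) = y := fun y => congrArg (· y) h
  ext x
  simp [dilate, h']

theorem dilate_pow (h : κ ∘L ι = .id ℂ Y) (W : Y →L[ℂ] Y) (n : ℕ) :
    dilate ι κ (W ^ (n + 1)) = dilate ι κ W ^ (n + 1) := by
  induction n with
  | zero => simp
  | succ n ih => rw [pow_succ, dilate_mul h, ih, ← pow_succ]

theorem dilate_one : dilate ι κ 1 = ι ∘L κ := rfl

theorem calkinMk_compress_congr {U V : X →L[ℂ] X} (h : calkinMk X U = calkinMk X V) :
    calkinMk Y (compress κ ι U) = calkinMk Y (compress κ ι V) := by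
  rw [calkinMk_eq_iff] at h ⊢
  rw [← compress_sub]
  exact isCompactOperator_compress h

theorem calkinMk_dilate_congr {V W : Y →L[ℂ] Y} (h : calkinMk Y V = calkinMk Y W) :
    calkinMk X (dilate ι κ V) = calkinMk X (dilate ι κ W) := by
  rw [calkinMk_eq_iff] at h ⊢
  rw [← dilate_sub]
  exact isCompactOperator_dilate h

theorem isCompactOperator_dilate_iff (h : κ ∘L ι = .id ℂ Y) {W : Y →L[ℂ] Y} :
    IsCompactOperator (dilate ι κ W) ↔ IsCompactOperator W := by
  refine ⟨fun hd => ?_, isCompactOperator_dilate⟩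
  rw [← compress_dilate h W]
  exact isCompactOperator_compress hd

/-- Modulo compact operators, compression is multiplicative on products whose first factor commutes
with the projection. -/
theorem calkinMk_compress_mul (h : κ ∘L ι = .id ℂ Y) {U V : X →L[ℂ] X}
    (hU : Commute (calkinMk X U) (calkinMk X (ι ∘L κ))) :
    calkinMk Y (compress κ ι (U * V)) =
      calkinMk Y (compress κ ι U) * calkinMk Y (compress κ ι V) := by
  have h' : ∀ y, κ (ι y) = y := fun y => congrArg (· y) h
  have e1 : compress κ ι U * compress κ ι V = compress κ ι (U * (ι ∘L κ) * V) := by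
    ext y; simp [compress]
  have e2 : compress κ ι (U * V) = compress κ ι ((ι ∘L κ) * U * V) := by
    ext y; simp [compress, h']
  rw [← map_mul, e1, e2]
  refine calkinMk_compress_congr ?_
  rw [map_mul, map_mul, map_mul, map_mul, hU.eq]

theorem isRiesz_iff {W : Y →L[ℂ] Y} :
    IsRiesz W ↔ ∀ μ : ℂ, μ ≠ 0 → IsUnit (calkinMk Y (algebraMap ℂ _ μ - W)) := by
  simp only [IsRiesz, spectralRadius, ENNReal.iSup_eq_zero, map_sub, AlgHom.commutes]
  constructor
  · intro h μ hμ
    by_contra hu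
    simpa [hμ] using h μ hu
  · intro h μ hu
    by_contra hμ
    exact hu (h μ (by simpa using hμ))

theorem IsPowerCompact.isRiesz {W : Y →L[ℂ] Y} (h : IsPowerCompact W) : IsRiesz W := by
  obtain ⟨n, -, hn⟩ := h
  have hnil : IsNilpotent (calkinMk Y W) :=
    ⟨n, by rw [← map_pow, calkinMk_eq_zero_iff]; exact hn⟩
  rw [isRiesz_iff]
  intro μ hμ
  rw [map_sub, AlgHom.commutes]
  rw [sub_eq_add_neg]
  exact hnil.neg.isUnit_add_left_of_commute ((IsUnit.mk0 μ hμ).map _)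
    (Algebra.commute_algebraMap_right μ _)

end Corner

/-! ### Operator decompositions and spectral splittings in the Calkin algebra -/

section Decomposition

variable {X Y₁ Y₂ : Type*} [NormedAddCommGroup X] [NormedSpace ℂ X] [CompleteSpace X]
  [NormedAddCommGroup Y₁] [NormedSpace ℂ Y₁] [NormedAddCommGroup Y₂] [NormedSpace ℂ Y₂]
  [CompleteSpace Y₂]

/-- The data of a direct sum decomposition `X = Y₁ ⊕ Y₂` with inclusions `ι₁`, `ι₂` and
projections `κ₁`, `κ₂`. -/
structure IsDirectSum (ι₁ : Y₁ →L[ℂ] X) (κ₁ : X →L[ℂ] Y₁) (ι₂ : Y₂ →L[ℂ] X) (κ₂ : X →L[ℂ] Y₂) :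
    Prop where
  proj_incl₁ : κ₁ ∘L ι₁ = .id ℂ Y₁
  proj_incl₂ : κ₂ ∘L ι₂ = .id ℂ Y₂
  proj_incl₁₂ : κ₁ ∘L ι₂ = 0
  proj_incl₂₁ : κ₂ ∘L ι₁ = 0
  incl_proj : ι₁ ∘L κ₁ + ι₂ ∘L κ₂ = 1

omit [CompleteSpace X] in
theorem isDirectSum_range {P : X →L[ℂ] X} (hP : IsIdempotentElem P) :
    IsDirectSum P.range.subtypeL (P.codRestrict P.range fun x => ⟨x, rfl⟩)
      (1 - P).range.subtypeL ((1 - P).codRestrict (1 - P).range fun x => ⟨x, rfl⟩) := by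
  refine ⟨?_, ?_, ?_, ?_, ?_⟩
  · ext ⟨_, u, rfl⟩
    exact congrArg (· u) hP.eq
  · ext ⟨_, u, rfl⟩
    exact congrArg (· u) hP.one_sub.eq
  · ext ⟨_, u, rfl⟩
    exact congrArg (· u) hP.mul_one_sub_self
  · ext ⟨_, u, rfl⟩
    exact congrArg (· u) hP.one_sub_mul_self
  · ext x
    change P x + (1 - P) x = x
    simp

namespace IsDirectSum

variable {ι₁ : Y₁ →L[ℂ] X} {κ₁ : X →L[ℂ] Y₁} {ι₂ : Y₂ →L[ℂ] X} {κ₂ : X →L[ℂ] Y₂}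

omit [CompleteSpace X] [CompleteSpace Y₂] in
theorem dilate_mul_dilate₁₂ (h : IsDirectSum ι₁ κ₁ ι₂ κ₂) (V : Y₁ →L[ℂ] Y₁) (W : Y₂ →L[ℂ] Y₂) :
    dilate ι₁ κ₁ V * dilate ι₂ κ₂ W = 0 := by
  have h' : ∀ y, κ₁ (ι₂ y) = 0 := fun y => congrArg (· y) h.proj_incl₁₂
  ext x
  simp [dilate, h']

omit [CompleteSpace X] [CompleteSpace Y₂] in
theorem dilate_mul_dilate₂₁ (h : IsDirectSum ι₁ κ₁ ι₂ κ₂) (V : Y₁ →L[ℂ] Y₁) (W : Y₂ →L[ℂ] Y₂) :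
    dilate ι₂ κ₂ W * dilate ι₁ κ₁ V = 0 := by
  have h' : ∀ y, κ₂ (ι₁ y) = 0 := fun y => congrArg (· y) h.proj_incl₂₁
  ext x
  simp [dilate, h']

omit [CompleteSpace X] [CompleteSpace Y₂] in
theorem dilate_one_add (h : IsDirectSum ι₁ κ₁ ι₂ κ₂) :
    dilate ι₁ κ₁ 1 + dilate ι₂ κ₂ 1 = 1 := h.incl_proj

/-- A decomposition of `T - z` modulo compacts into a Riesz operator and a Fredholm operator
splits the class of `T` in the Calkin algebra. -/
theorem exists_isSpectralSplitting (h : IsDirectSum ι₁ κ₁ ι₂ κ₂) {T : X →L[ℂ] X} {z : ℂ}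
    {T₁ : Y₁ →L[ℂ] Y₁} {T₂ : Y₂ →L[ℂ] Y₂} (h₁ : IsRiesz T₁) (h₂ : T₂.IsFredholm)
    (hT : calkinMk X T - algebraMap ℂ _ z = calkinMk X (dilate ι₁ κ₁ T₁ + dilate ι₂ κ₂ T₂)) :
    (∃ b, IsSpectralSplitting (calkinMk X T) z (calkinMk X (dilate ι₁ κ₁ 1)) b) ∧
      (calkinMk X T - algebraMap ℂ _ z) * calkinMk X (dilate ι₁ κ₁ 1) =
        calkinMk X (dilate ι₁ κ₁ T₁) := by
  obtain ⟨V, hV1, hV2⟩ := isUnit_calkinMk_iff.1 (isFredholm_iff_isUnit_calkinMk.1 h₂)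
  have hsum := congrArg (calkinMk X) h.dilate_one_add
  rw [map_add, map_one] at hsum
  have hsub : 1 - calkinMk X (dilate ι₁ κ₁ 1) = calkinMk X (dilate ι₂ κ₂ 1) :=
    sub_eq_of_eq_add' hsum.symm
  have hm₁ : ∀ W, calkinMk X (dilate ι₁ κ₁ W) * calkinMk X (dilate ι₁ κ₁ 1) =
      calkinMk X (dilate ι₁ κ₁ W) := fun W => by
    rw [← map_mul, ← dilate_mul h.proj_incl₁, mul_one]
  have hm₁' : ∀ W, calkinMk X (dilate ι₁ κ₁ 1) * calkinMk X (dilate ι₁ κ₁ W) =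
      calkinMk X (dilate ι₁ κ₁ W) := fun W => by
    rw [← map_mul, ← dilate_mul h.proj_incl₁, one_mul]
  have h12 : ∀ V W, calkinMk X (dilate ι₁ κ₁ V) * calkinMk X (dilate ι₂ κ₂ W) = 0 := fun V W => by
    rw [← map_mul, h.dilate_mul_dilate₁₂, map_zero]
  have h21 : ∀ V W, calkinMk X (dilate ι₂ κ₂ W) * calkinMk X (dilate ι₁ κ₁ V) = 0 := fun V W => by
    rw [← map_mul, h.dilate_mul_dilate₂₁, map_zero]
  have hTp : (calkinMk X T - algebraMap ℂ _ z) * calkinMk X (dilate ι₁ κ₁ 1) =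
      calkinMk X (dilate ι₁ κ₁ T₁) := by
    rw [hT, map_add, add_mul, hm₁, h21, add_zero]
  have hpT : calkinMk X (dilate ι₁ κ₁ 1) * (calkinMk X T - algebraMap ℂ _ z) =
      calkinMk X (dilate ι₁ κ₁ T₁) := by
    rw [hT, map_add, mul_add, hm₁', h12, add_zero]
  have hone : ∀ {W}, calkinMk Y₂ W = 1 → calkinMk X (dilate ι₂ κ₂ W) =
      1 - calkinMk X (dilate ι₁ κ₁ 1) := fun {W} hW => by
    rw [hsub]
    exact calkinMk_dilate_congr (by rw [hW, map_one])
  refine ⟨⟨calkinMk X (dilate ι₂ κ₂ V), hm₁ 1, ?_, ?_, ?_, h21 _ _, h12 _ _, fun μ hμ => ?_⟩, hTp⟩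
  · have hc : Commute (calkinMk X (dilate ι₁ κ₁ 1)) (calkinMk X T - algebraMap ℂ _ z) :=
      hpT.trans hTp.symm
    have := hc.add_right (Algebra.commute_algebraMap_right z _)
    rwa [sub_add_cancel] at this
  · rw [hT, map_add, add_mul, h12, zero_add, ← map_mul, ← dilate_mul h.proj_incl₂, hone hV1]
  · rw [hT, map_add, mul_add, h21, zero_add, ← map_mul, ← dilate_mul h.proj_incl₂, hone hV2]
  · obtain ⟨W, hW1, hW2⟩ := isUnit_calkinMk_iff.1 (isRiesz_iff.1 h₁ μ hμ)
    rw [hTp]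
    -- `μ - T₁ ⊕ 0` has the inverse `W ⊕ μ⁻¹` modulo compacts
    have hdec : algebraMap ℂ (X →L[ℂ] X) μ - dilate ι₁ κ₁ T₁ =
        dilate ι₁ κ₁ (algebraMap ℂ _ μ - T₁) + μ • dilate ι₂ κ₂ 1 := by
      have hd : dilate ι₁ κ₁ (algebraMap ℂ _ μ) = μ • dilate ι₁ κ₁ 1 := by
        ext x; simp [dilate, Algebra.algebraMap_eq_smul_one]
      rw [dilate_sub, hd, Algebra.algebraMap_eq_smul_one, ← h.dilate_one_add, smul_add]
      abel
    have hL : calkinMk X (algebraMap ℂ (X →L[ℂ] X) μ - dilate ι₁ κ₁ T₁) =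
        algebraMap ℂ _ μ - calkinMk X (dilate ι₁ κ₁ T₁) := by rw [map_sub, AlgHom.commutes]
    rw [← hL, isUnit_calkinMk_iff, hdec]
    have hone₁ : ∀ {U}, calkinMk Y₁ U = 1 → calkinMk X (dilate ι₁ κ₁ U) =
        calkinMk X (dilate ι₁ κ₁ 1) := fun {U} hU =>
      calkinMk_dilate_congr (by rw [hU, map_one])
    have hsq : dilate ι₂ κ₂ 1 * dilate ι₂ κ₂ 1 = dilate ι₂ κ₂ 1 := by
      rw [← dilate_mul h.proj_incl₂, one_mul]
    refine ⟨dilate ι₁ κ₁ W + μ⁻¹ • dilate ι₂ κ₂ 1, ?_, ?_⟩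
    · rw [add_mul, mul_add, mul_add, mul_smul_comm, h.dilate_mul_dilate₁₂, smul_mul_assoc,
        h.dilate_mul_dilate₂₁, smul_mul_smul_comm, hsq, mul_inv_cancel₀ hμ, one_smul, smul_zero,
        smul_zero, add_zero, zero_add, ← dilate_mul h.proj_incl₁, map_add, hone₁ hW1, hsum]
    · rw [add_mul, mul_add, mul_add, mul_smul_comm, h.dilate_mul_dilate₁₂, smul_mul_assoc,
        h.dilate_mul_dilate₂₁, smul_mul_smul_comm, hsq, inv_mul_cancel₀ hμ, one_smul, smul_zero,
        smul_zero, add_zero, zero_add, ← dilate_mul h.proj_incl₁, map_add, hone₁ hW2, hsum]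

omit [CompleteSpace Y₂] in
/-- The compression to the range of the projection of a splitting is Riesz. -/
theorem isRiesz_compress (h : IsDirectSum ι₁ κ₁ ι₂ κ₂) {T : X →L[ℂ] X} {z : ℂ} {b : Calkin X}
    (hs : IsSpectralSplitting (calkinMk X T) z (calkinMk X (ι₁ ∘L κ₁)) b) :
    IsRiesz (compress κ₁ ι₁ (T - algebraMap ℂ _ z)) := by
  rw [isRiesz_iff]
  intro μ hμ
  set S := T - algebraMap ℂ _ z with hS
  have hSc : calkinMk X S = calkinMk X T - algebraMap ℂ _ z := by
    rw [hS, map_sub, AlgHom.commutes]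
  have hu := hs.isUnit μ hμ
  have hcomm : Commute (calkinMk X (ι₁ ∘L κ₁)) (calkinMk X S) := by rw [hSc]; exact hs.comm_sub
  have hL : calkinMk X (algebraMap ℂ (X →L[ℂ] X) μ - S * (ι₁ ∘L κ₁)) =
      algebraMap ℂ _ μ - (calkinMk X T - algebraMap ℂ _ z) * calkinMk X (ι₁ ∘L κ₁) := by
    rw [map_sub, map_mul, hSc, AlgHom.commutes]
  rw [← hL] at hu
  have hcU : Commute (calkinMk X (ι₁ ∘L κ₁))
      (calkinMk X (algebraMap ℂ (X →L[ℂ] X) μ - S * (ι₁ ∘L κ₁))) := by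
    rw [hL, ← hSc]
    exact (Algebra.commute_algebraMap_right μ _).sub_right (hcomm.mul_right (Commute.refl _))
  obtain ⟨V, hV1, hV2⟩ := isUnit_calkinMk_iff.1 hu
  have hcV : Commute (calkinMk X (ι₁ ∘L κ₁)) (calkinMk X V) := by
    set u : (Calkin X)ˣ := ⟨_, calkinMk X V, by rw [← map_mul]; exact hV1,
      by rw [← map_mul]; exact hV2⟩ with hudef
    have hcu : Commute (calkinMk X (ι₁ ∘L κ₁)) (u : Calkin X) := hcU
    exact hcu.units_inv_right
  have hcomp : compress κ₁ ι₁ (algebraMap ℂ (X →L[ℂ] X) μ - S * (ι₁ ∘L κ₁)) =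
      algebraMap ℂ _ μ - compress κ₁ ι₁ S := by
    have h' : ∀ y, κ₁ (ι₁ y) = y := fun y => congrArg (· y) h.proj_incl₁
    rw [compress_sub, compress_algebraMap h.proj_incl₁]
    congr 1
    ext y; simp [compress, h']
  have hone : ∀ {U}, calkinMk X U = 1 → calkinMk Y₁ (compress κ₁ ι₁ U) = 1 := fun {U} hU => by
    rw [calkinMk_compress_congr (V := 1) (by rw [hU, map_one]), compress_one h.proj_incl₁, map_one]
  rw [← hcomp, isUnit_calkinMk_iff]
  refine ⟨compress κ₁ ι₁ V, ?_, ?_⟩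
  · rw [map_mul, ← calkinMk_compress_mul h.proj_incl₁ hcU.symm, hone hV1]
  · rw [map_mul, ← calkinMk_compress_mul h.proj_incl₁ hcV.symm, hone hV2]

/-- The compression to the complement of the range of the projection of a splitting is Fredholm. -/
theorem isFredholm_compress (h : IsDirectSum ι₁ κ₁ ι₂ κ₂) {T : X →L[ℂ] X} {z : ℂ} {b : Calkin X}
    (hs : IsSpectralSplitting (calkinMk X T) z (calkinMk X (ι₁ ∘L κ₁)) b) :
    (compress κ₂ ι₂ (T - algebraMap ℂ _ z)).IsFredholm := by
  rw [isFredholm_iff_isUnit_calkinMk, isUnit_calkinMk_iff]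
  set S := T - algebraMap ℂ _ z with hS
  have hSc : calkinMk X S = calkinMk X T - algebraMap ℂ _ z := by
    rw [hS, map_sub, AlgHom.commutes]
  have hq : calkinMk X (ι₂ ∘L κ₂) = 1 - calkinMk X (ι₁ ∘L κ₁) := by
    rw [← map_one (calkinMk X), ← map_sub, ← h.incl_proj, add_sub_cancel_left]
  obtain ⟨B, hB⟩ := calkinMk_surjective b
  have hcS : Commute (calkinMk X S) (calkinMk X (ι₂ ∘L κ₂)) := by
    rw [hq, hSc]
    exact ((Commute.one_left _).sub_left hs.comm_sub).symm
  have hcB : Commute (calkinMk X B) (calkinMk X (ι₂ ∘L κ₂)) := by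
    rw [hq, hB, Commute, SemiconjBy, mul_sub, sub_mul, hs.mul_proj, hs.proj_mul, mul_one, one_mul]
  have hone : ∀ {U}, calkinMk X U = 1 - calkinMk X (ι₁ ∘L κ₁) →
      calkinMk Y₂ (compress κ₂ ι₂ U) = 1 := fun {U} hU => by
    rw [calkinMk_compress_congr (V := dilate ι₂ κ₂ 1) (by rw [hU, dilate_one, hq]),
      compress_dilate h.proj_incl₂, map_one]
  refine ⟨compress κ₂ ι₂ B, ?_, ?_⟩
  · rw [map_mul, ← calkinMk_compress_mul h.proj_incl₂ hcS]
    exact hone (by rw [map_mul, hSc, hB, hs.sub_mul])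
  · rw [map_mul, ← calkinMk_compress_mul h.proj_incl₂ hcB]
    exact hone (by rw [map_mul, hSc, hB, hs.mul_sub])

omit [CompleteSpace Y₂] in
/-- An operator commuting with the projection modulo compacts is, modulo compacts, the sum of its
diagonal blocks. -/
theorem calkinMk_eq_dilate_compress (h : IsDirectSum ι₁ κ₁ ι₂ κ₂) {S : X →L[ℂ] X}
    (hS : Commute (calkinMk X (ι₁ ∘L κ₁)) (calkinMk X S)) :
    calkinMk X S = calkinMk X
      (dilate ι₁ κ₁ (compress κ₁ ι₁ S) + dilate ι₂ κ₂ (compress κ₂ ι₂ S)) := by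
  have h' : ∀ y, κ₁ (ι₁ y) = y := fun y => congrArg (· y) h.proj_incl₁
  have hidem : calkinMk X (ι₁ ∘L κ₁) * calkinMk X (ι₁ ∘L κ₁) = calkinMk X (ι₁ ∘L κ₁) := by
    rw [← map_mul]
    congr 1
    ext x; simp [h']
  have hq : ι₂ ∘L κ₂ = 1 - ι₁ ∘L κ₁ := by rw [← h.incl_proj, add_sub_cancel_left]
  have e1 : dilate ι₁ κ₁ (compress κ₁ ι₁ S) = (ι₁ ∘L κ₁) * S * (ι₁ ∘L κ₁) := rfl
  have e2 : dilate ι₂ κ₂ (compress κ₂ ι₂ S) = (ι₂ ∘L κ₂) * S * (ι₂ ∘L κ₂) := rfl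
  rw [e1, e2, hq]
  simp only [map_add, map_mul, map_sub, map_one]
  set p := calkinMk X (ι₁ ∘L κ₁)
  set s := calkinMk X S
  have hps : p * s * p = s * p := by rw [hS.eq, mul_assoc, hidem]
  rw [sub_mul, one_mul, mul_sub, mul_one, sub_mul, hps, hS.eq]
  abel

end IsDirectSum

end Decomposition

/-! ### Block sums along an idempotent operator -/

section BlockSum

variable {X : Type*} [NormedAddCommGroup X] [NormedSpace ℂ X] [CompleteSpace X]

theorem completeSpace_range {P : X →L[ℂ] X} (hP : IsIdempotentElem P) : CompleteSpace P.range :=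
  (ContinuousLinearMap.IsIdempotentElem.isClosed_range hP).completeSpace_coe

omit [CompleteSpace X] in
theorem calkinMk_sub_smul_one (T : X →L[ℂ] X) (z : ℂ) :
    calkinMk X (T - z • 1) = calkinMk X T - algebraMap ℂ _ z := by
  rw [← Algebra.algebraMap_eq_smul_one, map_sub, AlgHom.commutes]

/-- Every isolated point of the spectrum in the Calkin algebra comes from a decomposition into a
Riesz and a Fredholm operator. -/
theorem exists_blockSum_of_mem_isoSpectrum {T : X →L[ℂ] X} {z : ℂ}
    (hz : z ∈ isoSpectrum (calkinMk X T)) :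
    ∃ P : X →L[ℂ] X, IsIdempotentElem P ∧ ¬ IsCompactOperator P ∧
      ∃ (T₁ : P.range →L[ℂ] P.range) (T₂ : (1 - P).range →L[ℂ] (1 - P).range) (K : X →L[ℂ] X),
        IsRiesz T₁ ∧ T₂.IsFredholm ∧ IsCompactOperator K ∧
        T - z • (1 : X →L[ℂ] X) = blockSum P T₁ T₂ + K := by
  obtain ⟨p, b, hs⟩ := exists_isSpectralSplitting
    (eventually_mem_resolventSet_of_not_accPt hz.2)
  obtain ⟨P, hP, rfl⟩ := exists_isIdempotentElem_calkinMk_eq hs.idem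
  have := completeSpace_range hP.one_sub
  have hd := isDirectSum_range hP
  refine ⟨P, hP, fun hc => hs.ne_zero hz.1 (calkinMk_eq_zero_iff.2 hc), _, _,
    T - z • (1 : X →L[ℂ] X) - blockSum P _ _, hd.isRiesz_compress (T := T) (z := z) (b := b) hs,
    hd.isFredholm_compress (T := T) (z := z) (b := b) hs, ?_, (add_sub_cancel _ _).symm⟩
  rw [← calkinMk_eq_iff, ← Algebra.algebraMap_eq_smul_one]
  refine hd.calkinMk_eq_dilate_compress ?_
  rw [map_sub, AlgHom.commutes]
  exact hs.comm_sub

/-- A decomposition into a Riesz and a Fredholm operator gives an isolated point of the spectrum in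
the Calkin algebra, which is a pole exactly when the Riesz part is power compact. -/
theorem mem_isoSpectrum_of_blockSum {T : X →L[ℂ] X} {z : ℂ} {P : X →L[ℂ] X}
    (hP : IsIdempotentElem P) (hPc : ¬ IsCompactOperator P) {T₁ : P.range →L[ℂ] P.range}
    {T₂ : (1 - P).range →L[ℂ] (1 - P).range} {K : X →L[ℂ] X} (h₁ : IsRiesz T₁)
    (h₂ : T₂.IsFredholm) (hK : IsCompactOperator K)
    (hT : T - z • (1 : X →L[ℂ] X) = blockSum P T₁ T₂ + K) :
    z ∈ isoSpectrum (calkinMk X T) ∧ (z ∈ poles (calkinMk X T) ↔ IsPowerCompact T₁) := by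
  have := completeSpace_range hP.one_sub
  have hd := isDirectSum_range hP
  have hT' := congrArg (calkinMk X) hT
  rw [calkinMk_sub_smul_one, map_add, calkinMk_eq_zero_iff.2 hK, add_zero] at hT'
  obtain ⟨⟨b, hs⟩, hTp⟩ := hd.exists_isSpectralSplitting h₁ h₂ hT'
  have hp : calkinMk X (dilate P.range.subtypeL (P.codRestrict P.range fun x => ⟨x, rfl⟩) 1) ≠ 0 :=
    fun h => hPc (calkinMk_eq_zero_iff.1 h)
  refine ⟨hs.mem_isoSpectrum hp, ?_⟩
  rw [hs.mem_poles_iff hp, hTp]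
  refine exists_congr fun n => and_congr_right fun hn => ?_
  obtain ⟨m, rfl⟩ : ∃ m, n = m + 1 := ⟨n - 1, by omega⟩
  rw [← map_pow, ← dilate_pow hd.proj_incl₁, calkinMk_eq_zero_iff,
    isCompactOperator_dilate_iff hd.proj_incl₁]

end BlockSum

end CalkinTheory

theorem theorem3p7 {X : Type*} [NormedAddCommGroup X] [NormedSpace ℂ X] [CompleteSpace X]
    (T : X →L[ℂ] X) (z : ℂ) :
    (z ∈ CalkinTheory.isoSpectrum (CalkinTheory.calkinMk X T) ↔
      ∃ P : X →L[ℂ] X, IsIdempotentElem P ∧ ¬ IsCompactOperator P ∧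
        ∃ (T₁ : P.range →L[ℂ] P.range) (T₂ : (1 - P).range →L[ℂ] (1 - P).range)
          (K : X →L[ℂ] X),
          CalkinTheory.IsRiesz T₁ ∧ T₂.IsFredholm ∧ IsCompactOperator K ∧
          T - z • (1 : X →L[ℂ] X) = CalkinTheory.blockSum P T₁ T₂ + K) ∧
    (z ∈ CalkinTheory.poles (CalkinTheory.calkinMk X T) ↔
      ∃ P : X →L[ℂ] X, IsIdempotentElem P ∧ ¬ IsCompactOperator P ∧
        ∃ (T₁ : P.range →L[ℂ] P.range) (T₂ : (1 - P).range →L[ℂ] (1 - P).range)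
          (K : X →L[ℂ] X),
          CalkinTheory.IsPowerCompact T₁ ∧ T₂.IsFredholm ∧ IsCompactOperator K ∧
          T - z • (1 : X →L[ℂ] X) = CalkinTheory.blockSum P T₁ T₂ + K) ∧
    (z ∈ CalkinTheory.nonpoleIso (CalkinTheory.calkinMk X T) ↔
      ∃ P : X →L[ℂ] X, IsIdempotentElem P ∧ ¬ IsCompactOperator P ∧
        ∃ (T₁ : P.range →L[ℂ] P.range) (T₂ : (1 - P).range →L[ℂ] (1 - P).range)
          (K : X →L[ℂ] X),
          (CalkinTheory.IsRiesz T₁ ∧ ¬ CalkinTheory.IsPowerCompact T₁) ∧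
          T₂.IsFredholm ∧ IsCompactOperator K ∧
          T - z • (1 : X →L[ℂ] X) = CalkinTheory.blockSum P T₁ T₂ + K) := by
  refine ⟨⟨CalkinTheory.exists_blockSum_of_mem_isoSpectrum, ?_⟩, ⟨fun hz => ?_, ?_⟩,
    ⟨fun hz => ?_, ?_⟩⟩
  · rintro ⟨P, hP, hPc, T₁, T₂, K, h₁, h₂, hK, hT⟩
    exact (CalkinTheory.mem_isoSpectrum_of_blockSum hP hPc h₁ h₂ hK hT).1
  · have hiso : z ∈ CalkinTheory.isoSpectrum (CalkinTheory.calkinMk X T) := by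
      obtain ⟨n, hn⟩ := hz
      exact hn.1
    obtain ⟨P, hP, hPc, T₁, T₂, K, h₁, h₂, hK, hT⟩ :=
      CalkinTheory.exists_blockSum_of_mem_isoSpectrum hiso
    exact ⟨P, hP, hPc, T₁, T₂, K,
      (CalkinTheory.mem_isoSpectrum_of_blockSum hP hPc h₁ h₂ hK hT).2.1 hz, h₂, hK, hT⟩
  · rintro ⟨P, hP, hPc, T₁, T₂, K, h₁, h₂, hK, hT⟩
    exact (CalkinTheory.mem_isoSpectrum_of_blockSum hP hPc h₁.isRiesz h₂ hK hT).2.2 h₁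
  · obtain ⟨P, hP, hPc, T₁, T₂, K, h₁, h₂, hK, hT⟩ :=
      CalkinTheory.exists_blockSum_of_mem_isoSpectrum hz.1
    exact ⟨P, hP, hPc, T₁, T₂, K, ⟨h₁, fun hpc => hz.2
      ((CalkinTheory.mem_isoSpectrum_of_blockSum hP hPc h₁ h₂ hK hT).2.2 hpc)⟩, h₂, hK, hT⟩
  · rintro ⟨P, hP, hPc, T₁, T₂, K, ⟨h₁, hnot⟩, h₂, hK, hT⟩
    have h := CalkinTheory.mem_isoSpectrum_of_blockSum hP hPc h₁ h₂ hK hT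
    exact ⟨h.1, fun hz => hnot (h.2.1 hz)⟩
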